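/- **Setting.** Let $\mathcal F^2$ be the Fock space of entire functions $f$ with $\frac1\pi\int_{\mathbb C}|f(z)|^2e^{-|z|^2}\,dV(z)<\infty$, with inner product $\langle f,g\rangle=\frac1\pi\int_{\mathbb C} f(z)\overline{g(z)}e^{-|z|^2}\,dV(z)$. Let $a,b,c\in\mathbb C$ satisfy $|a|=1$, $\bar ab+\bar b=0$, $|c|^2e^{|b|^2}=1$, and let $\mathcal C_{a,b,c}$ be the conjugation $\mathcal C_{a,b,c}f(z)=ce^{bz}\overline{f(\overline{az+b})}$ of $\mathcal F^2$. For a conjugation $\mathcal C$, an operator $A$ is *$\mathcal C$-symmetric* if $\langle\mathcal Cx,Ay\rangle=\langle\mathcal CAx,y\rangle$ for all $x,y\in\operatorname{dom}(A)$, and *$\mathcal C$-selfadjoint* if it is densely defined and $A=\mathcal CA^*\mathcal C$. For a family $T=(T(t))_{t\ge0}$ of (unbounded) linear operators on a Hilbert space, let $\mathfrak D(T)$ be the set of all $x\in\bigcap_{t,s\ge0}\operatorname{dom}(T(t)T(s))$ such that $T(t)T(s)x=T(t+s)x$ for all $t,s\ge0$, $t\mapsto T(t)x$ is continuous on $(0,\infty)$,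 and $\lim_{t\to0^+}\|T(t)x-x\|=0$. The family is an *unbounded $C_0$-semigroup* if $\mathfrak D(T)\ne\{0\}$. For $\omega\in\mathbb R$ put $\Sigma_\omega=\{x\in\mathfrak D(T):\sup_{t\ge0}e^{-\omega t}\|T(t)x\|<\infty\}$. The *generator* of $T$ is the operator $A$ whose domain consists of all $x=\int_0^\infty e^{-\lambda t}T(t)y\,dt$ with $\omega\in\mathbb R$, $\operatorname{Re}\lambda>\omega$, $y\in\Sigma_\omega$, and $Ax=\lambda x-y$ for such $x$. **Statement.** Let $\ell,G,H\in\mathbb C$, $\ell\ne0$, and for $t\ge0$ let $$\zeta_t(z)=e^{\ell t}z+G(1-e^{\ell t}),\qquad \xi_t(z)=\exp\!\big[Ht+G(aG+b)(e^{\ell t}-\ell t-1)\big]\,e^{z(aG+b)(1-e^{\ell t})}.$$ Let $W=(W(t))_{t\ge0}$ be an unbounded $C_0$-semigroup on $\mathcal F^2$ such that each $W(t)$ is a $\mathcal C_{a,b,c}$-selfadjoint operator with $W(t)f=\xi_t\cdot(f\circ\zeta_t)$ for all $f\in\operatorname{dom}(W(t))$, where $\operatorname{dom}(W(t))\subseteq\{f\in\mathcal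 F^2:\xi_t\cdot(f\circ\zeta_t)\in\mathcal F^2\}$. Then: 1. $W$ has a generator $R$, and it is given by $$\operatorname{dom}(R)=\bigcup_{\omega\in\mathbb R}\{f\in\Sigma_\omega:[H-\ell(aG+b)z]f+\ell(z-G)f'\in\Sigma_\omega\},$$ $$Rf(z)=[H-\ell(aG+b)z]f(z)+\ell(z-G)f'(z)\qquad(f\in\operatorname{dom}(R),\ z\in\mathbb C).$$ 2. $R$ is $\mathcal C_{a,b,c}$-symmetric. 3. If $\ell$ is real with $\ell>0$ and $aG+b\ne0$, then $R$ is densely defined (so $R^*$ exists), $R$ is not $\mathcal C_{a,b,c}$-selfadjoint, and the adjoint family $(W(t)^*)_{t\ge0}$ is an unbounded $C_0$-semigroup that has a generator, but $R^*$ is not its generator. 4. The point spectrum satisfies $\sigma_p(R)\subseteq\{H-\ell(aG+b)G+k\ell:k\in\mathbb N\}$, where $\mathbb N=\{0,1,2,\dots\}$. -/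

import Mathlib

open MeasureTheory Complex
open scoped ComplexConjugate Topology

noncomputable section

namespace CSym

/-! ## The Fock space -/

/-- The Gaussian measure `π⁻¹ e^{-|z|²} dV(z)` on the complex plane. -/
def gaussian : Measure ℂ :=
  (volume : Measure ℂ).withDensity fun z => ENNReal.ofReal (Real.pi⁻¹ * Real.exp (-‖z‖ ^ 2))

/-- `f` is an entire function that is square integrable for the Gaussian measure. -/
def MemFock (f : ℂ → ℂ) : Prop :=
  Differentiable ℂ f ∧ MemLp f 2 gaussian

/-- The entire functions in the Fock space, as a linear subspace of all functions. -/
def fockSubmodule : Submodule ℂ (ℂ → ℂ) where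
  carrier := {f | MemFock f}
  add_mem' hf hg := ⟨hf.1.add hg.1, hf.2.add hg.2⟩
  zero_mem' := ⟨differentiable_const 0, MemLp.zero⟩
  smul_mem' c _ hf := ⟨hf.1.const_smul c, hf.2.const_smul c⟩

/-- The Fock space. -/
def Fock : Type := fockSubmodule

namespace Fock

instance : AddCommGroup Fock := inferInstanceAs (AddCommGroup fockSubmodule)

instance : Module ℂ Fock := inferInstanceAs (Module ℂ fockSubmodule)

instance : FunLike Fock ℂ ℂ where
  coe f := f.1
  coe_injective _ _ h := Subtype.ext h

/-- An element of the Fock space from an entire function and its square integrability. -/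
def mk (f : ℂ → ℂ) (hf : MemFock f) : Fock := ⟨f, hf⟩

@[simp] theorem mk_apply (f : ℂ → ℂ) (hf : MemFock f) (z : ℂ) : mk f hf z = f z := rfl

@[simp] theorem add_apply (f g : Fock) (z : ℂ) : (f + g) z = f z + g z := rfl

@[simp] theorem smul_apply (c : ℂ) (f : Fock) (z : ℂ) : (c • f) z = c * f z := rfl

@[simp] theorem sub_apply (f g : Fock) (z : ℂ) : (f - g) z = f z - g z := rfl

@[simp] theorem zero_apply (z : ℂ) : (0 : Fock) z = 0 := rfl

@[ext] theorem ext {f g : Fock} (h : ∀ z, f z = g z) : f = g := DFunLike.ext f g h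

theorem differentiable (f : Fock) : Differentiable ℂ f := f.2.1

theorem memLp (f : Fock) : MemLp f 2 gaussian := f.2.2

theorem measurable_dens :
    Measurable fun z : ℂ => ENNReal.ofReal (Real.pi⁻¹ * Real.exp (-‖z‖ ^ 2)) := by
  fun_prop

theorem dens_pos (z : ℂ) : 0 < Real.pi⁻¹ * Real.exp (-‖z‖ ^ 2) := by positivity

theorem volume_ac : (volume : Measure ℂ) ≪ gaussian :=
  withDensity_absolutelyContinuous' measurable_dens.aemeasurable
    (Filter.Eventually.of_forall fun z => by simpa using dens_pos z)

theorem eq_of_ae {f g : ℂ → ℂ} (hf : Continuous f) (hg : Continuous g)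
    (h : f =ᵐ[gaussian] g) : f = g :=
  Continuous.ae_eq_iff_eq (volume : Measure ℂ) hf hg |>.1 (volume_ac.ae_le h)

theorem integral_gaussian {E : Type*} [NormedAddCommGroup E] [NormedSpace ℝ E] (f : ℂ → E) :
    ∫ z, f z ∂gaussian = ∫ z, (Real.pi⁻¹ * Real.exp (-‖z‖ ^ 2)) • f z := by
  unfold gaussian
  rw [integral_withDensity_eq_integral_toReal_smul measurable_dens
    (Filter.Eventually.of_forall fun z => ENNReal.ofReal_lt_top)]
  simp_rw [ENNReal.toReal_ofReal (dens_pos _).le]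

theorem integrable_gaussian {E : Type*} [NormedAddCommGroup E] [NormedSpace ℝ E] (f : ℂ → E) :
    Integrable f gaussian ↔ Integrable fun z => (Real.pi⁻¹ * Real.exp (-‖z‖ ^ 2)) • f z := by
  unfold gaussian
  rw [integrable_withDensity_iff_integrable_smul' measurable_dens
    (Filter.Eventually.of_forall fun z => ENNReal.ofReal_lt_top)]
  simp_rw [ENNReal.toReal_ofReal (dens_pos _).le]

/-- The class of `f` in `L²` of the Gaussian measure. -/
def toL2 (f : Fock) : Lp ℂ 2 gaussian := f.memLp.toLp f

theorem coeFn_toL2 (f : Fock) : toL2 f =ᵐ[gaussian] f := f.memLp.coeFn_toLp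

/-- The inner product `⟨f, g⟩ = π⁻¹ ∫ conj (f z) g z e^{-|z|²} dV(z)`, conjugate-linear in the
first variable. -/
instance : Inner ℂ Fock := ⟨fun f g => ∫ z, conj (f z) * g z ∂gaussian⟩

theorem inner_def (f g : Fock) : inner ℂ f g = ∫ z, conj (f z) * g z ∂gaussian := rfl

theorem inner_toL2 (f g : Fock) : inner ℂ (toL2 f) (toL2 g) = inner ℂ f g := by
  rw [L2.inner_def, inner_def]
  refine integral_congr_ae ?_
  filter_upwards [coeFn_toL2 f, coeFn_toL2 g] with z h1 h2
  rw [h1, h2, RCLike.inner_apply, mul_comm]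

theorem toL2_add (f g : Fock) : toL2 (f + g) = toL2 f + toL2 g := rfl

theorem toL2_smul (c : ℂ) (f : Fock) : toL2 (c • f) = c • toL2 f := rfl

theorem toL2_injective : Function.Injective toL2 := fun f g h => by
  refine DFunLike.coe_injective (eq_of_ae f.differentiable.continuous g.differentiable.continuous ?_)
  exact (coeFn_toL2 f).symm.trans (h ▸ coeFn_toL2 g)

/-- The Fock inner product satisfies the axioms. -/
@[reducible] def core : InnerProductSpace.Core ℂ Fock where
  conj_inner_symm f g := by
    rw [← inner_toL2, ← inner_toL2]; exact inner_conj_symm _ _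
  re_inner_nonneg f := by
    rw [← inner_toL2]; exact inner_self_nonneg
  add_left f g h := by
    rw [← inner_toL2, ← inner_toL2, ← inner_toL2, toL2_add]; exact inner_add_left _ _ _
  smul_left f g r := by
    rw [← inner_toL2, ← inner_toL2, toL2_smul]; exact inner_smul_left _ _ _
  definite f h := by
    rw [← inner_toL2] at h
    exact toL2_injective (inner_self_eq_zero.1 h)

instance : NormedAddCommGroup Fock := @InnerProductSpace.Core.toNormedAddCommGroup ℂ _ _ _ _ core

instance : InnerProductSpace ℂ Fock := InnerProductSpace.ofCore core.toCore

/-- The isometric embedding into `L²`. -/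
def toL2ₗᵢ : Fock →ₗᵢ[ℂ] Lp ℂ 2 gaussian where
  toFun := toL2
  map_add' := toL2_add
  map_smul' := toL2_smul
  norm_map' f := by
    simp only [LinearMap.coe_mk, AddHom.coe_mk]
    rw [@norm_eq_sqrt_re_inner ℂ, @norm_eq_sqrt_re_inner ℂ _ _ _ _ f, inner_toL2]

theorem norm_sq_eq (f : Fock) : ‖f‖ ^ 2 = ∫ z, ‖f z‖ ^ 2 ∂gaussian := by
  have h : (inner ℂ f f : ℂ) = ((‖f‖ ^ 2 : ℝ) : ℂ) := by
    rw [inner_self_eq_norm_sq_to_K]; norm_num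
  have h2 : (inner ℂ f f : ℂ) = ((∫ z, ‖f z‖ ^ 2 ∂gaussian : ℝ) : ℂ) := by
    rw [inner_def, ← integral_complex_ofReal]
    refine integral_congr_ae (Filter.Eventually.of_forall fun z => ?_)
    change conj (f z) * f z = _
    rw [mul_comm, mul_conj, normSq_eq_norm_sq]
  exact_mod_cast h.symm.trans h2

theorem integral_dens : ∫ z : ℂ, Real.pi⁻¹ * Real.exp (-‖z‖ ^ 2) = 1 := by
  have h := GaussianFourier.integral_rexp_neg_mul_sq_norm (V := ℂ) (b := 1) one_pos
  rw [integral_const_mul]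
  simp only [neg_mul, one_mul, div_one, finrank_real_complex] at h
  rw [h]
  norm_num [Real.pi_ne_zero]

theorem integrable_dens : Integrable fun z : ℂ => Real.pi⁻¹ * Real.exp (-‖z‖ ^ 2) := by
  by_contra h
  have := integral_undef h
  rw [integral_dens] at this
  exact one_ne_zero this

instance : IsProbabilityMeasure gaussian := by
  refine ⟨?_⟩
  unfold gaussian
  rw [withDensity_apply _ MeasurableSet.univ, Measure.restrict_univ,
    ← ofReal_integral_eq_lintegral_ofReal integrable_dens
      (Filter.Eventually.of_forall fun z => (dens_pos z).le), integral_dens, ENNReal.ofReal_one]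

theorem measurePreserving_rot (u : ℂ) (hu : ‖u‖ = 1) :
    MeasurePreserving (fun w : ℂ => u * w) volume volume ∧
      MeasurableEmbedding fun w : ℂ => u * w := by
  let U : Circle := ⟨u, by simpa [Submonoid.unitSphere] using hu⟩
  exact ⟨(rotation U).measurePreserving, (rotation U).toHomeomorph.measurableEmbedding⟩

theorem integral_rot {E : Type*} [NormedAddCommGroup E] [NormedSpace ℝ E] (h : ℂ → E) (u : ℂ)
    (hu : ‖u‖ = 1) : ∫ w, h (u * w) ∂gaussian = ∫ w, h w ∂gaussian := by
  obtain ⟨h1, h2⟩ := measurePreserving_rot u hu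
  rw [integral_gaussian, integral_gaussian,
    ← h1.integral_comp h2 fun w => (Real.pi⁻¹ * Real.exp (-‖w‖ ^ 2)) • h w]
  simp_rw [norm_mul, hu, one_mul]

theorem integrable_rot (h : ℂ → ℂ) (u : ℂ) (hu : ‖u‖ = 1) (hi : Integrable h gaussian) :
    Integrable (fun w => h (u * w)) gaussian := by
  obtain ⟨h1, h2⟩ := measurePreserving_rot u hu
  rw [integrable_gaussian, ← h1.integrable_comp_emb h2] at hi
  rw [integrable_gaussian]
  simpa only [Function.comp_def, norm_mul, hu, one_mul] using hi

/-- Mean value property for the Gaussian measure. -/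
theorem integral_gaussian_eq (h : ℂ → ℂ) (hd : Differentiable ℂ h) (hi : Integrable h gaussian) :
    ∫ w, h w ∂gaussian = h 0 := by
  have hu : ∀ θ : ℝ, ‖circleMap 0 1 θ‖ = 1 := fun θ => by simp
  have hG : Integrable (Function.uncurry fun (θ : ℝ) (w : ℂ) => h (circleMap 0 1 θ * w))
      ((volume.restrict (Set.Ioc 0 (2 * Real.pi))).prod gaussian) := by
    have hm : Continuous (Function.uncurry fun (θ : ℝ) (w : ℂ) => h (circleMap 0 1 θ * w)) :=
      hd.continuous.comp
        (((continuous_circleMap 0 1).comp continuous_fst).mul continuous_snd)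
    rw [integrable_prod_iff hm.aestronglyMeasurable]
    simp only [Function.uncurry_apply_pair]
    refine ⟨Filter.Eventually.of_forall fun θ =>
      integrable_rot h (circleMap 0 1 θ) (hu θ) hi, ?_⟩
    have : ∀ θ : ℝ, ∫ w, ‖h (circleMap 0 1 θ * w)‖ ∂gaussian = ∫ w, ‖h w‖ ∂gaussian :=
      fun θ => integral_rot (fun w => ‖h w‖) _ (hu θ)
    simp_rw [this]
    exact integrable_const _
  have h1 : ∀ w, ∫ θ in Set.Ioc 0 (2 * Real.pi), h (circleMap 0 1 θ * w) =
      (2 * Real.pi) • h 0 := by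
    intro w
    have hdw : Differentiable ℂ fun u => h (u * w) := by fun_prop
    have := (hdw.diffContOnCl (s := Metric.ball 0 |(1 : ℝ)|)).circleAverage
    rw [Real.circleAverage_def, zero_mul,
      intervalIntegral.integral_of_le (by positivity)] at this
    rw [← this, smul_inv_smul₀ (by positivity)]
  have h2 := integral_integral_swap hG
  simp_rw [h1, integral_rot h _ (hu _)] at h2
  simp only [integral_const, Measure.real, Measure.restrict_apply_univ, Real.volume_Ioc,
    measure_univ, ENNReal.toReal_one, one_smul, sub_zero,
    ENNReal.toReal_ofReal Real.two_pi_pos.le] at h2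
  exact smul_right_injective ℂ Real.two_pi_pos.ne' h2

theorem translate_aux (f : ℂ → ℂ) (z w : ℂ) :
    (Real.pi⁻¹ * Real.exp (-‖w‖ ^ 2)) • ‖f (z + w) * exp (-(w * conj z))‖ ^ 2 =
      Real.exp (‖z‖ ^ 2) *
        ((Real.pi⁻¹ * Real.exp (-‖z + w‖ ^ 2)) • ‖f (z + w)‖ ^ 2) := by
  have h : ‖z + w‖ ^ 2 = ‖z‖ ^ 2 + ‖w‖ ^ 2 + 2 * (w * conj z).re := by
    rw [← normSq_eq_norm_sq, ← normSq_eq_norm_sq, ← normSq_eq_norm_sq, normSq_add]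
    simp
    ring
  rw [norm_mul, mul_pow, norm_exp, h, smul_eq_mul, smul_eq_mul, ← Real.exp_nat_mul]
  have : Real.exp (-(‖z‖ ^ 2 + ‖w‖ ^ 2 + 2 * (w * conj z).re)) =
      Real.exp (-‖z‖ ^ 2) * Real.exp (-‖w‖ ^ 2) * Real.exp ((2 : ℕ) * (-(w * conj z)).re) := by
    rw [← Real.exp_add, ← Real.exp_add]; congr 1; simp; ring
  rw [this, Real.exp_neg (‖z‖ ^ 2)]
  field_simp

theorem translate_memLp (f : Fock) (z : ℂ) :
    MemLp (fun w => f (z + w) * exp (-(w * conj z))) 2 gaussian ∧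
    ∫ w, ‖f (z + w) * exp (-(w * conj z))‖ ^ 2 ∂gaussian = Real.exp (‖z‖ ^ 2) * ‖f‖ ^ 2 := by
  have hd := f.differentiable.continuous
  have hf := f.memLp
  rw [memLp_two_iff_integrable_sq_norm (by fun_prop), integrable_gaussian] at hf ⊢
  rw [integral_gaussian, norm_sq_eq, integral_gaussian]
  simp_rw [translate_aux]
  exact ⟨(hf.comp_add_left z).const_mul _, by
    rw [integral_const_mul, integral_add_left_eq_self
      (fun w => (Real.pi⁻¹ * Real.exp (-‖w‖ ^ 2)) • ‖f w‖ ^ 2) z]⟩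

/-- Point evaluations are bounded on the Fock space. -/
theorem norm_apply_le (f : Fock) (z : ℂ) : ‖f z‖ ≤ Real.exp (‖z‖ ^ 2 / 2) * ‖f‖ := by
  obtain ⟨h1, h2⟩ := translate_memLp f z
  have hd := f.differentiable
  have h3 := integral_gaussian_eq _ (by fun_prop) (h1.integrable one_le_two)
  simp only [add_zero, zero_mul, neg_zero, Complex.exp_zero, mul_one] at h3
  set h := fun w => f (z + w) * exp (-(w * conj z)) with hh
  have h4 : ‖f z‖ ≤ ∫ w, ‖h w‖ ∂gaussian := h3 ▸ norm_integral_le_integral_norm _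
  have h5 : (∫ w, ‖h w‖ ∂gaussian) ^ 2 ≤ ∫ w, ‖h w‖ ^ 2 ∂gaussian := by
    set m := ∫ w, ‖h w‖ ∂gaussian with hm
    have hn : Integrable (fun w => ‖h w‖) gaussian := (h1.integrable one_le_two).norm
    have hs : Integrable (fun w => ‖h w‖ ^ 2) gaussian :=
      (memLp_two_iff_integrable_sq_norm h1.1).1 h1
    have : 0 ≤ ∫ w, (‖h w‖ ^ 2 - 2 * m * ‖h w‖ + m ^ 2) ∂gaussian :=
      integral_nonneg fun w => by
        change 0 ≤ ‖h w‖ ^ 2 - 2 * m * ‖h w‖ + m ^ 2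
        nlinarith [sq_nonneg (‖h w‖ - m)]
    rw [integral_add (f := fun w => ‖h w‖ ^ 2 - 2 * m * ‖h w‖) (hs.sub (hn.const_mul _))
      (integrable_const _), integral_sub hs (hn.const_mul _), integral_const_mul, ← hm] at this
    simp at this
    nlinarith
  rw [h2] at h5
  refine h4.trans (abs_le_of_sq_le_sq' ?_ (by positivity)).2
  rw [mul_pow, ← Real.exp_nat_mul]
  have : ((2 : ℕ) : ℝ) * (‖z‖ ^ 2 / 2) = ‖z‖ ^ 2 := by push_cast; ring
  rwa [this]

instance : CompleteSpace Fock := by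
  have hcl : IsClosed (Set.range toL2ₗᵢ) := by
    refine isSeqClosed_iff_isClosed.1 fun u g hu hg => ?_
    choose f hf using hu
    have hfc : CauchySeq f := by
      have := hg.cauchySeq
      rw [Metric.cauchySeq_iff] at this ⊢
      simpa only [← hf, toL2ₗᵢ.isometry.dist_eq] using this
    have hpc : ∀ z, CauchySeq fun n => f n z := fun z => by
      rw [Metric.cauchySeq_iff'] at hfc ⊢
      intro ε hε
      obtain ⟨N, hN⟩ := hfc (ε / Real.exp (‖z‖ ^ 2 / 2)) (by positivity)
      refine ⟨N, fun n hn => ?_⟩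
      have := hN n hn
      rw [dist_eq_norm, lt_div_iff₀' (by positivity)] at this
      rw [dist_eq_norm, ← sub_apply]
      exact (norm_apply_le _ _).trans_lt this
    choose F hF using fun z => cauchySeq_tendsto_of_complete (hpc z)
    have hlu : TendstoLocallyUniformlyOn (fun n z => f n z) F Filter.atTop Set.univ := by
      rw [tendstoLocallyUniformlyOn_iff_forall_isCompact isOpen_univ]
      intro K _ hK
      obtain ⟨r, hr⟩ := hK.isBounded.exists_norm_le
      refine UniformCauchySeqOn.tendstoUniformlyOn_of_tendsto ?_ fun z _ => hF z
      rw [Metric.uniformCauchySeqOn_iff]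
      intro ε hε
      rw [Metric.cauchySeq_iff] at hfc
      obtain ⟨N, hN⟩ := hfc (ε / Real.exp (r ^ 2 / 2)) (by positivity)
      refine ⟨N, fun m hm n hn z hz => ?_⟩
      have := hN m hm n hn
      rw [dist_eq_norm, lt_div_iff₀' (by positivity)] at this
      rw [dist_eq_norm, ← sub_apply]
      refine (norm_apply_le _ _).trans_lt (lt_of_le_of_lt ?_ this)
      have := hr z hz
      gcongr
    have hd : Differentiable ℂ F := by
      rw [← differentiableOn_univ]
      exact hlu.differentiableOn
        (Filter.Eventually.of_forall fun n => (f n).differentiable.differentiableOn) isOpen_univ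
    obtain ⟨ns, _, hns⟩ := (tendstoInMeasure_of_tendsto_Lp hg).exists_seq_tendsto_ae
    have hae : g =ᵐ[gaussian] F := by
      have h1 : ∀ᵐ z ∂gaussian, ∀ n, u n z = f n z := ae_all_iff.2 fun n => by
        rw [← hf n]; exact coeFn_toL2 (f n)
      filter_upwards [hns, h1] with z hz h1
      simp_rw [h1] at hz
      exact tendsto_nhds_unique hz ((hF z).comp ‹StrictMono ns›.tendsto_atTop)
    refine ⟨mk F ⟨hd, (memLp_congr_ae hae).1 (Lp.memLp g)⟩, ?_⟩
    exact Lp.ext ((coeFn_toL2 _).trans hae.symm)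
  exact (completeSpace_iff_isComplete_range toL2ₗᵢ.isometry.isUniformInducing).2 hcl.isComplete

end Fock

/-! ## Conjugations and complex symmetry -/

section Hilbert

variable {H : Type*} [NormedAddCommGroup H] [InnerProductSpace ℂ H]

/-- A conjugation: an anti-linear, isometric involution. -/
structure Conjugation (H : Type*) [NormedAddCommGroup H] [InnerProductSpace ℂ H] where
  /-- the underlying map -/
  toFun : H → H
  map_add : ∀ x y, toFun (x + y) = toFun x + toFun y
  map_smul : ∀ (c : ℂ) x, toFun (c • x) = conj c • toFun x
  norm_map : ∀ x, ‖toFun x‖ = ‖x‖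
  involutive : Function.Involutive toFun

instance : CoeFun (Conjugation H) fun _ => H → H := ⟨Conjugation.toFun⟩

/-- The operator `C T C`, with domain `{x | C x ∈ dom T}`. -/
def Conjugation.conjOp (C : Conjugation H) (T : H →ₗ.[ℂ] H) : H →ₗ.[ℂ] H where
  domain :=
    { carrier := {x | C x ∈ T.domain}
      add_mem' := fun {x y} hx hy => by
        change C (x + y) ∈ T.domain
        rw [C.map_add]; exact T.domain.add_mem hx hy
      zero_mem' := by
        change C 0 ∈ T.domain
        have h := C.map_smul 0 0
        rw [zero_smul, map_zero, zero_smul] at h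
        rw [h]; exact T.domain.zero_mem
      smul_mem' := fun c x hx => by
        change C (c • x) ∈ T.domain
        rw [C.map_smul]; exact T.domain.smul_mem _ hx }
  toFun :=
    { toFun := fun x => C (T ⟨C x, x.2⟩)
      map_add' := fun x y => by
        rw [← C.map_add, ← T.map_add]
        congr 2
        exact Subtype.ext (C.map_add x y)
      map_smul' := fun c x => by
        have h : T ⟨C ↑(c • x), (c • x).2⟩ = conj c • T ⟨C x, x.2⟩ := by
          rw [← T.map_smul]
          congr 1
          exact Subtype.ext (C.map_smul c x)
        rw [h, C.map_smul, conj_conj, RingHom.id_apply] }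

/-- `T` is `C`-symmetric: `⟨C x, T y⟩ = ⟨C T x, y⟩` for all `x, y ∈ dom T`. -/
def IsCSymmetric (C : Conjugation H) (T : H →ₗ.[ℂ] H) : Prop :=
  ∀ x y : T.domain, inner ℂ (C x) (T y) = inner ℂ (C (T x)) (y : H)

/-- `T` is `C`-selfadjoint: it is densely defined and `T = C T* C`. -/
def IsCSelfAdjoint [CompleteSpace H] (C : Conjugation H) (T : H →ₗ.[ℂ] H) : Prop :=
  Dense (T.domain : Set H) ∧ T = C.conjOp T.adjoint

/-- The point spectrum of an unbounded operator. -/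
def pointSpectrum (A : H →ₗ.[ℂ] H) : Set ℂ :=
  {η | ∃ x : A.domain, (x : H) ≠ 0 ∧ A x = η • (x : H)}

/-! ## Semigroups of unbounded operators

A family `(T(t))_{t ≥ 0}` is indexed by `ℝ`, and only its members with `0 ≤ t` matter. -/

open Classical in
/-- The value `A x` for `x ∈ dom A`, and zero otherwise. -/
def opApply (A : H →ₗ.[ℂ] H) (x : H) : H :=
  if h : x ∈ A.domain then A ⟨x, h⟩ else 0

/-- The intersection of the domains of all products `T(t) T(s)`, where `s, t ≥ 0`. -/
def productDomain (T : ℝ → H →ₗ.[ℂ] H) : Set H :=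
  {x | ∀ t s : ℝ, 0 ≤ t → 0 ≤ s → x ∈ (T s).domain ∧ opApply (T s) x ∈ (T t).domain}

/-- The vectors on which the family satisfies the semigroup law and is strongly continuous
(the zero vector included). -/
def regularVectors (T : ℝ → H →ₗ.[ℂ] H) : Set H :=
  {x | x ∈ productDomain T ∧
    (∀ t s : ℝ, 0 ≤ t → 0 ≤ s → opApply (T t) (opApply (T s) x) = opApply (T (t + s)) x) ∧
    ContinuousOn (fun t => opApply (T t) x) (Set.Ioi 0) ∧
    Filter.Tendsto (fun t => ‖opApply (T t) x - x‖) (𝓝[>] 0) (𝓝 0)}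

/-- An unbounded `C₀`-semigroup: some nonzero vector is regular. -/
def IsUnboundedC0Semigroup (T : ℝ → H →ₗ.[ℂ] H) : Prop :=
  ∃ x ∈ regularVectors T, x ≠ 0

/-- The space `Σ_ω` of the regular vectors `x` with `sup_{t ≥ 0} e^{-ωt} ‖T(t)x‖ < ∞`. -/
def sigmaSpace (T : ℝ → H →ₗ.[ℂ] H) (ω : ℝ) : Set H :=
  {x | x ∈ regularVectors T ∧
    BddAbove ((fun t : ℝ => Real.exp (-(ω * t)) * ‖opApply (T t) x‖) '' Set.Ici 0)}

/-- The Laplace transform `∫₀^∞ e^{-μt} T(t)x dt`. -/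
def laplace (T : ℝ → H →ₗ.[ℂ] H) (μ : ℂ) (x : H) : H :=
  ∫ t in Set.Ioi (0 : ℝ), exp (-(μ * t)) • opApply (T t) x

/-- `A` is the generator of the family `T`: the domain of `A` consists of the vectors
`x = ∫₀^∞ e^{-μt} T(t)y dt` with `y ∈ Σ_ω` and `Re μ > ω` for some `ω ∈ ℝ`, and `A x = μ x - y`
for such `x`. -/
def IsGenerator (T : ℝ → H →ₗ.[ℂ] H) (A : H →ₗ.[ℂ] H) : Prop :=
  ∀ x z : H, (x, z) ∈ A.graph ↔
    ∃ (ω : ℝ) (μ : ℂ) (y : H), ω < μ.re ∧ y ∈ sigmaSpace T ω ∧ x = laplace T μ y ∧ z = μ • x - y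

/-- A family has at most one generator. -/
theorem IsGenerator.unique {T : ℝ → H →ₗ.[ℂ] H} {A B : H →ₗ.[ℂ] H} (hA : IsGenerator T A)
    (hB : IsGenerator T B) : A = B :=
  LinearPMap.eq_of_eq_graph (Submodule.ext fun p => (hA p.1 p.2).trans (hB p.1 p.2).symm)

end Hilbert

/-! ## Weighted composition operators and conjugations on the Fock space -/

/-- The maximal weighted composition operator `f ↦ ψ · f ∘ φ`, whose domain consists of all `f` in
the Fock space for which `ψ · f ∘ φ` lies in the Fock space. -/
def wcMax (ψ φ : ℂ → ℂ) : Fock →ₗ.[ℂ] Fock where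
  domain :=
    { carrier := {f | MemFock fun z => ψ z * f (φ z)}
      add_mem' := fun {f g} hf hg => by
        have h := fockSubmodule.add_mem hf hg
        have e : (fun z => ψ z * (f + g) (φ z)) =
            (fun z => ψ z * f (φ z)) + fun z => ψ z * g (φ z) := by
          ext z; simp [mul_add]
        change MemFock _
        rw [e]; exact h
      zero_mem' := by
        have e : (fun z => ψ z * (0 : Fock) (φ z)) = 0 := by
          ext z; simp
        change MemFock _
        rw [e]; exact fockSubmodule.zero_mem
      smul_mem' := fun c f hf => by
        have h := fockSubmodule.smul_mem c hf
        have e : (fun z => ψ z * (c • f) (φ z)) = c • fun z => ψ z * f (φ z) := by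
          ext z; simp; ring
        change MemFock _
        rw [e]; exact h }
  toFun :=
    { toFun := fun f => Fock.mk (fun z => ψ z * (f : Fock) (φ z)) f.2
      map_add' := fun f g => by ext z; simp [mul_add]
      map_smul' := fun c f => by ext z; simp; ring }

/-- The admissible parameters of a weighted composition conjugation. -/
structure ConjParam (a b c : ℂ) : Prop where
  norm_a : ‖a‖ = 1
  ab : conj a * b + conj b = 0
  norm_c : ‖c‖ ^ 2 * Real.exp (‖b‖ ^ 2) = 1

namespace ConjParam

variable {a b c : ℂ}

theorem conj_a_mul (h : ConjParam a b c) : conj a * a = 1 := by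
  rw [mul_comm, mul_conj, normSq_eq_norm_sq, h.norm_a]; norm_num

theorem b_eq (h : ConjParam a b c) : b = -(a * conj b) := by
  linear_combination a * h.ab - b * h.conj_a_mul

theorem weight (h : ConjParam a b c) (f : ℂ → ℂ) (z : ℂ) :
    (Real.pi⁻¹ * Real.exp (-‖z‖ ^ 2)) •
        ‖c * exp (b * z) * conj (f (conj (a * z + b)))‖ ^ 2 =
      (Real.pi⁻¹ * Real.exp (-‖conj (a * z + b)‖ ^ 2)) • ‖f (conj (a * z + b))‖ ^ 2 := by
  have h1 : ‖conj (a * z + b)‖ ^ 2 = ‖z‖ ^ 2 - 2 * (b * z).re + ‖b‖ ^ 2 := by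
    have e : (b * z).re = -(a * z * conj b).re := by
      conv_lhs => rw [h.b_eq]
      rw [← neg_re]; congr 1; ring
    rw [norm_conj, ← normSq_eq_norm_sq, normSq_add, normSq_eq_norm_sq, normSq_eq_norm_sq, norm_mul,
      h.norm_a, e]
    ring
  have h2 : Real.exp (-‖conj (a * z + b)‖ ^ 2) * Real.exp (‖b‖ ^ 2) =
      Real.exp (-‖z‖ ^ 2) * Real.exp ((b * z).re) ^ 2 := by
    rw [h1, ← Real.exp_nat_mul, ← Real.exp_add, ← Real.exp_add]; congr 1; push_cast; ring
  rw [norm_mul, norm_mul, norm_exp, norm_conj, smul_eq_mul, smul_eq_mul]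
  linear_combination Real.pi⁻¹ * ‖f (conj (a * z + b))‖ ^ 2 *
    (Real.exp (-‖conj (a * z + b)‖ ^ 2) * h.norm_c - ‖c‖ ^ 2 * h2)

theorem measurePreserving (h : ConjParam a b c) :
    MeasurePreserving (fun z : ℂ => conj (a * z + b)) volume volume ∧
      MeasurableEmbedding fun z : ℂ => conj (a * z + b) := by
  obtain ⟨h1, h2⟩ := Fock.measurePreserving_rot a h.norm_a
  refine ⟨(conjLIE.measurePreserving.comp (measurePreserving_add_right volume b)).comp h1, ?_⟩
  exact (conjLIE.toHomeomorph.measurableEmbedding.comp (measurableEmbedding_addRight b)).comp h2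

theorem memFock (h : ConjParam a b c) (f : Fock) :
    MemFock fun z => c * exp (b * z) * conj (f (conj (a * z + b))) := by
  have hd : Differentiable ℂ fun z => conj (f (conj z)) := fun z => by
    have := (f.differentiable (conj z)).conj_conj
    rwa [conj_conj] at this
  have hd2 : Differentiable ℂ fun z => c * exp (b * z) * conj (f (conj (a * z + b))) := by
    have : Differentiable ℂ fun z => conj (f (conj (a * z + b))) :=
      hd.comp (g := fun z => conj (f (conj z))) (f := fun z => a * z + b) (by fun_prop)
    fun_prop
  refine ⟨hd2, ?_⟩
  obtain ⟨h1, h2⟩ := h.measurePreserving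
  have hf := f.memLp
  rw [memLp_two_iff_integrable_sq_norm f.differentiable.continuous.aestronglyMeasurable,
    Fock.integrable_gaussian, ← h1.integrable_comp_emb h2] at hf
  rw [memLp_two_iff_integrable_sq_norm hd2.continuous.aestronglyMeasurable,
    Fock.integrable_gaussian]
  simp_rw [h.weight f]
  exact hf

end ConjParam

/-- The weighted composition conjugation `f ↦ c e^{bz} conj (f (conj (a z + b)))`. -/
def wcConj (a b c : ℂ) (h : ConjParam a b c) : Conjugation Fock where
  toFun f := Fock.mk (fun z => c * exp (b * z) * conj (f (conj (a * z + b)))) (h.memFock f)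
  map_add f g := by ext z; simp [mul_add]
  map_smul r f := by ext z; simp; ring
  norm_map f := by
    obtain ⟨h1, h2⟩ := h.measurePreserving
    rw [← sq_eq_sq₀ (norm_nonneg _) (norm_nonneg _), Fock.norm_sq_eq, Fock.norm_sq_eq,
      Fock.integral_gaussian, Fock.integral_gaussian,
      ← h1.integral_comp h2 fun z => (Real.pi⁻¹ * Real.exp (-‖z‖ ^ 2)) • ‖f z‖ ^ 2]
    simp_rw [Fock.mk_apply, h.weight f]
  involutive f := by
    ext z
    have e1 : conj (a * conj (a * z + b) + b) = z := by
      simp only [map_add, map_mul, conj_conj]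
      linear_combination z * h.conj_a_mul + h.ab
    have e2 : c * conj c * exp (conj b * b) = 1 := by
      rw [mul_conj, normSq_eq_norm_sq, mul_comm (conj b), mul_conj, normSq_eq_norm_sq,
        ← ofReal_exp, ← ofReal_mul, h.norm_c, ofReal_one]
    have e3 : exp (b * z) * exp (conj b * (a * z + b)) = exp (conj b * b) := by
      rw [← Complex.exp_add]; congr 1
      linear_combination z * h.b_eq
    simp only [Fock.mk_apply, e1, map_mul, ← exp_conj, conj_conj]
    linear_combination f z * c * conj c * e3 + f z * e2

/-- The semiflow `ζ_t(z) = e^{ℓt} z + G (1 - e^{ℓt})`. -/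
def semiflow (ℓ G : ℂ) (t : ℝ) (z : ℂ) : ℂ :=
  exp (ℓ * t) * z + G * (1 - exp (ℓ * t))

/-- The semicocycle `ξ_t(z) = C(t) e^{z D(t)}` with `D(t) = (aG + b)(1 - e^{ℓt})` and
`C(t) = exp (Ht + G (aG + b)(e^{ℓt} - ℓt - 1))`. -/
def semicocycle (a b ℓ G H : ℂ) (t : ℝ) (z : ℂ) : ℂ :=
  exp (H * t + G * (a * G + b) * (exp (ℓ * t) - ℓ * t - 1)) *
    exp (z * ((a * G + b) * (1 - exp (ℓ * t))))

end CSym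

end

/-!
The semicocycle solves `∂ξ/∂t = ξ · (p ∘ ζ)` along the flow `ζ` of `F z = ℓ (z - G)`, where
`p z = H - ℓ (aG + b) z`. Hence `d/dt (ξ_t · f ∘ ζ_t) = ξ_t · (p f + F f') ∘ ζ_t`, and integrating
by parts in the Laplace transform identifies the generator with `f ↦ p f + F f'`. Laplace transforms
commute with the symmetric form `⟨C x, y⟩`, so the generator inherits the symmetry of the family,
and the adjoint family, being conjugate to `T`, has the conjugate generator.

The adjoint of a weighted composition operator maps reproducing kernels to multiples of reproducing
kernels. By `C`-selfadjointness `T t` does the same, and differentiating in the parameter of the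
kernel, closedness puts every `(z - G)ᵏ e^{U (z - G)}` into its domain. For `U = aG + b` these are
joint eigenvectors of the `T t`; they span a dense subspace of the domain of the generator. The
adjoint of the generator contains all kernels in its domain. If the generator were `C`-selfadjoint,
its own domain would contain the constant `1`, whose orbit `ξ_t` grows like `exp (|aG + b|² e^{ℓt})`
at suitable bounded points, which no `Σ_ω` allows. Eigenfunctions are found by comparing orders of
vanishing at the fixed point `G` of the flow.
-/

noncomputable section

namespace CSym

section Hilbert

variable {H : Type*} [NormedAddCommGroup H] [InnerProductSpace ℂ H]

namespace Conjugation

variable (C : Conjugation H)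

@[simp] theorem apply_apply (x : H) : C (C x) = x := C.involutive x

theorem map_neg (x : H) : C (-x) = -C x := by simpa using C.map_smul (-1) x

theorem map_sub (x y : H) : C (x - y) = C x - C y := by
  rw [sub_eq_add_neg, C.map_add, C.map_neg, ← sub_eq_add_neg]

theorem re_inner_map_map (x y : H) : (inner ℂ (C x) (C y)).re = (inner ℂ x y).re := by
  have polarization := fun x y : H =>
    re_inner_eq_norm_add_mul_self_sub_norm_sub_mul_self_div_four (𝕜 := ℂ) x y
  simp only [RCLike.re_to_complex] at polarization
  rw [polarization, polarization, ← C.map_add, ← C.map_sub, C.norm_map, C.norm_map]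

theorem inner_map_map (x y : H) : inner ℂ (C x) (C y) = inner ℂ y x := by
  have im_eq : ∀ u v : H, (inner ℂ u v).im = -(inner ℂ u (I • v)).re := fun u v => by
    rw [inner_smul_right, I_mul_re, neg_neg]
  rw [← inner_conj_symm y x]
  refine Complex.ext (C.re_inner_map_map x y) ?_
  have hI : I • C y = -C (I • y) := by rw [C.map_smul, conj_I, neg_smul, neg_neg]
  rw [im_eq, hI, inner_neg_right, neg_re, C.re_inner_map_map, conj_im, im_eq x y]

theorem inner_map_left (x y : H) : inner ℂ (C x) y = inner ℂ (C y) x := by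
  rw [← C.inner_map_map, C.apply_apply]

/-- A conjugation as a real-linear isometric equivalence. -/
def toLinearIsometryEquiv : H ≃ₗᵢ[ℝ] H where
  toFun := C
  invFun := C
  left_inv := C.involutive
  right_inv := C.involutive
  map_add' := C.map_add
  map_smul' r x := by
    change C (r • x) = r • C x
    rw [← Complex.coe_smul, C.map_smul, conj_ofReal, Complex.coe_smul]
  norm_map' := C.norm_map

theorem continuous : Continuous C := C.toLinearIsometryEquiv.continuous

theorem integral_comp {α : Type*} [MeasurableSpace α] (ν : Measure α) (f : α → H) :
    ∫ t, C (f t) ∂ν = C (∫ t, f t ∂ν) :=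
  C.toLinearIsometryEquiv.toContinuousLinearEquiv.integral_comp_comm f

theorem mem_graph_conjOp {A : H →ₗ.[ℂ] H} {x y : H} :
    (x, y) ∈ (C.conjOp A).graph ↔ (C x, C y) ∈ A.graph := by
  simp only [LinearPMap.mem_graph_iff]
  constructor
  · rintro ⟨u, rfl, rfl⟩
    exact ⟨⟨C u, u.2⟩, rfl, (C.apply_apply _).symm⟩
  · rintro ⟨⟨u, hu⟩, rfl, h⟩
    exact ⟨⟨x, hu⟩, rfl, (congrArg C h).trans (C.apply_apply y)⟩

theorem conjOp_conjOp (A : H →ₗ.[ℂ] H) : C.conjOp (C.conjOp A) = A :=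
  LinearPMap.eq_of_eq_graph <| Submodule.ext fun _ => by
    rw [mem_graph_conjOp, mem_graph_conjOp, C.apply_apply, C.apply_apply]

theorem isClosed_conjOp {A : H →ₗ.[ℂ] H} (hA : A.IsClosed) : (C.conjOp A).IsClosed := by
  have h : ((C.conjOp A).graph : Set (H × H)) = Prod.map C C ⁻¹' A.graph :=
    Set.ext fun _ => C.mem_graph_conjOp
  rw [LinearPMap.IsClosed, h]
  exact IsClosed.preimage (C.continuous.prodMap C.continuous) hA

end Conjugation

theorem mem_graph_iff_opApply {A : H →ₗ.[ℂ] H} {x y : H} :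
    (x, y) ∈ A.graph ↔ x ∈ A.domain ∧ opApply A x = y := by
  rw [LinearPMap.mem_graph_iff]
  constructor
  · rintro ⟨x, rfl, rfl⟩
    exact ⟨x.2, dif_pos x.2⟩
  · rintro ⟨hx, rfl⟩
    exact ⟨⟨x, hx⟩, rfl, (dif_pos hx : opApply A x = A ⟨x, hx⟩).symm⟩

namespace IsCSymmetric

theorem inner_eq {C : Conjugation H} {A : H →ₗ.[ℂ] H} (h : IsCSymmetric C A) {x x' y y' : H}
    (hx : (x, x') ∈ A.graph) (hy : (y, y') ∈ A.graph) : inner ℂ (C x) y' = inner ℂ (C x') y := by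
  obtain ⟨x, rfl, rfl⟩ := A.mem_graph_iff.1 hx
  obtain ⟨y, rfl, rfl⟩ := A.mem_graph_iff.1 hy
  exact h x y

end IsCSymmetric

namespace IsCSelfAdjoint

variable [CompleteSpace H] {C : Conjugation H} {A : H →ₗ.[ℂ] H}

theorem adjoint_eq (h : IsCSelfAdjoint C A) : A.adjoint = C.conjOp A := by
  conv_rhs => rw [h.2]
  rw [C.conjOp_conjOp]

theorem isClosed (h : IsCSelfAdjoint C A) : A.IsClosed := by
  rw [h.2]
  exact C.isClosed_conjOp (LinearPMap.adjoint_isClosed h.1)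

theorem isCSymmetric (h : IsCSelfAdjoint C A) : IsCSymmetric C A := fun x y => by
  have hx : (C x, C (A x)) ∈ A.adjoint.graph := by
    rw [h.adjoint_eq, C.mem_graph_conjOp, C.apply_apply, C.apply_apply]
    exact A.mem_graph x
  obtain ⟨u, hu, hu'⟩ := LinearPMap.mem_graph_iff _ |>.1 hx
  dsimp only at hu hu'
  rw [← hu, ← hu']
  exact (LinearPMap.adjoint_isFormalAdjoint h.1 u y).symm

end IsCSelfAdjoint

end Hilbert

section Integral

variable {E F α : Type*} [NormedAddCommGroup E] [NormedSpace ℂ E] [CompleteSpace E]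
  [NormedAddCommGroup F] [NormedSpace ℂ F] [CompleteSpace F] [MeasurableSpace α] {ν : Measure α}

theorem integral_mem_of_isClosed {K : Submodule ℂ E} (hK : IsClosed (K : Set E)) {f : α → E}
    (hf : ∀ᵐ t ∂ν, f t ∈ K) : ∫ t, f t ∂ν ∈ K := by
  by_cases hi : Integrable f ν
  · have := hK
    have h : K.mkQL (∫ t, f t ∂ν) = 0 := by
      rw [← K.mkQL.integral_comp_comm hi, integral_eq_zero_of_ae]
      filter_upwards [hf] with t ht
      exact (Submodule.Quotient.mk_eq_zero K).2 ht
    exact (Submodule.Quotient.mk_eq_zero K).1 h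
  · rw [integral_undef hi]
    exact K.zero_mem

theorem integral_mem_graph {A : E →ₗ.[ℂ] F} (hA : A.IsClosed) {f : α → E} {g : α → F}
    (hf : Integrable f ν) (hg : Integrable g ν) (h : ∀ᵐ t ∂ν, (f t, g t) ∈ A.graph) :
    (∫ t, f t ∂ν, ∫ t, g t ∂ν) ∈ A.graph := by
  rw [← integral_pair hf hg]
  exact integral_mem_of_isClosed hA h

end Integral

section LaplaceTransform

variable {E : Type*} [NormedAddCommGroup E] {ω M : ℝ} {μ : ℂ} {u : ℝ → E}

theorem norm_comp_add_le_mul_exp (hM : ∀ t, 0 ≤ t → ‖u t‖ ≤ M * Real.exp (ω * t)) {s : ℝ}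
    (hs : 0 ≤ s) (t : ℝ) (ht : 0 ≤ t) :
    ‖u (s + t)‖ ≤ M * Real.exp (ω * s) * Real.exp (ω * t) := by
  rw [mul_assoc, ← Real.exp_add, ← mul_add]
  exact hM (s + t) (add_nonneg hs ht)

theorem continuousOn_comp_add (hu : ContinuousOn u (Set.Ioi 0)) {s : ℝ} (hs : 0 ≤ s) :
    ContinuousOn (fun t => u (s + t)) (Set.Ioi 0) :=
  hu.comp (by fun_prop) fun _ ht => add_pos_of_nonneg_of_pos hs ht

variable [NormedSpace ℂ E]

/-- The Laplace transform at `μ` of the translate of `u` by `s`. When `u` is the orbit of `y` under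
a semigroup, it is the orbit of the Laplace transform of `y`. -/
def laplaceShift (μ : ℂ) (u : ℝ → E) (s : ℝ) : E :=
  ∫ t in Set.Ioi (0 : ℝ), exp (-(μ * t)) • u (s + t)

theorem norm_exp_neg_mul_smul_le {y : E} {t : ℝ} (h : ‖y‖ ≤ M * Real.exp (ω * t)) :
    ‖exp (-(μ * t)) • y‖ ≤ M * Real.exp ((ω - μ.re) * t) := by
  have e : Real.exp ((ω - μ.re) * t) = Real.exp (-(μ.re * t)) * Real.exp (ω * t) := by
    rw [← Real.exp_add]; ring_nf
  rw [norm_smul, norm_exp, neg_re, re_mul_ofReal, e, mul_left_comm]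
  gcongr

theorem integrableOn_exp_neg_mul_smul (hu : ContinuousOn u (Set.Ioi 0))
    (hM : ∀ t, 0 ≤ t → ‖u t‖ ≤ M * Real.exp (ω * t)) (hμ : ω < μ.re) :
    IntegrableOn (fun t : ℝ => exp (-(μ * t)) • u t) (Set.Ioi 0) := by
  refine ((integrableOn_exp_mul_Ioi (sub_neg.2 hμ) 0).const_mul M).mono' ?_ ?_
  · exact (ContinuousOn.smul (by fun_prop) hu).aestronglyMeasurable measurableSet_Ioi
  · filter_upwards [ae_restrict_mem measurableSet_Ioi] with t ht
    exact norm_exp_neg_mul_smul_le (hM t (le_of_lt ht))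

theorem norm_laplaceShift_le (hM : ∀ t, 0 ≤ t → ‖u t‖ ≤ M * Real.exp (ω * t)) (hμ : ω < μ.re)
    {s : ℝ} (hs : 0 ≤ s) : ‖laplaceShift μ u s‖ ≤ M / (μ.re - ω) * Real.exp (ω * s) := by
  have hω : ω - μ.re < 0 := sub_neg.2 hμ
  calc ‖laplaceShift μ u s‖
      ≤ ∫ t in Set.Ioi (0 : ℝ), M * Real.exp (ω * s) * Real.exp ((ω - μ.re) * t) := by
        refine norm_integral_le_of_norm_le ((integrableOn_exp_mul_Ioi hω 0).const_mul _) ?_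
        filter_upwards [ae_restrict_mem measurableSet_Ioi] with t ht
        exact norm_exp_neg_mul_smul_le (norm_comp_add_le_mul_exp hM hs t (le_of_lt ht))
    _ = M / (μ.re - ω) * Real.exp (ω * s) := by
        rw [integral_const_mul, integral_exp_mul_Ioi hω, mul_zero, Real.exp_zero,
          ← neg_sub μ.re ω, neg_div_neg_eq]
        ring

theorem laplaceShift_eq_exp_smul_integral_Ioi (μ : ℂ) (u : ℝ → E) (s : ℝ) :
    laplaceShift μ u s = exp (μ * s) • ∫ t in Set.Ioi s, exp (-(μ * t)) • u t := by
  have h := (measurePreserving_add_left volume s).setIntegral_preimage_emb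
    (measurableEmbedding_addLeft s) (fun t : ℝ => exp (-(μ * t)) • u t) (Set.Ioi s)
  rw [Set.preimage_const_add_Ioi, sub_self] at h
  rw [← h, ← integral_smul, laplaceShift]
  refine integral_congr_ae (.of_forall fun t => ?_)
  dsimp only
  rw [smul_smul, ← Complex.exp_add]
  push_cast
  ring_nf

theorem continuousOn_laplaceShift
    (hu : IntegrableOn (fun t : ℝ => exp (-(μ * t)) • u t) (Set.Ioi 0)) :
    ContinuousOn (laplaceShift μ u) (Set.Ici 0) := by
  simp_rw [funext (laplaceShift_eq_exp_smul_integral_Ioi μ u)]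
  exact ContinuousOn.smul (by fun_prop) hu.continuousOn_Ici_primitive_Ioi

theorem hasDerivWithinAt_laplaceShift_zero [CompleteSpace E]
    (hu : IntegrableOn (fun t : ℝ => exp (-(μ * t)) • u t) (Set.Ioi 0)) {y : E}
    (hy : Filter.Tendsto u (𝓝[>] 0) (𝓝 y)) :
    HasDerivWithinAt (laplaceShift μ u) (μ • laplaceShift μ u 0 - y) (Set.Ici 0) 0 := by
  set w : ℝ → E := fun t => exp (-(μ * t)) • u t
  have hw : Filter.Tendsto w (𝓝[>] 0) (𝓝 y) := by
    have hexp : ContinuousWithinAt (fun t : ℝ => exp (-(μ * t))) (Set.Ioi 0) 0 := by fun_prop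
    simpa using hexp.tendsto.smul hy
  have hprim : HasDerivWithinAt (fun s => ∫ t in (0 : ℝ)..s, w t) y (Set.Ici 0) 0 :=
    intervalIntegral.integral_hasDerivWithinAt_of_tendsto_ae_right (t := Set.Ioi 0) .refl
      ⟨Set.Ioi 0, self_mem_nhdsWithin, hu.aestronglyMeasurable⟩ (hw.mono_left inf_le_left)
  have hexp : HasDerivWithinAt (fun s : ℝ => exp (μ * s)) μ (Set.Ici 0) 0 := by
    simpa using ((hasDerivAt_const_mul μ).cexp.comp_ofReal (z := 0)).hasDerivWithinAt
  have h := hexp.smul ((hasDerivWithinAt_const 0 (Set.Ici 0) (∫ t in Set.Ioi 0, w t)).sub hprim)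
  convert h.congr_of_mem (fun s hs => ?_) Set.self_mem_Ici using 1
  · simp [laplaceShift, w, sub_eq_neg_add]
  · rw [laplaceShift_eq_exp_smul_integral_Ioi]
    simp only [Pi.smul_apply', Pi.sub_apply]
    rw [eq_sub_of_add_eq' (intervalIntegral.integral_interval_add_Ioi hu
      (hu.mono_set (Set.Ioi_subset_Ioi hs)))]

theorem integral_exp_neg_mul_mul_sub {k k' : ℝ → ℂ} (hk : ∀ t, 0 ≤ t → HasDerivAt k (k' t) t)
    (hint : IntegrableOn (fun t : ℝ => exp (-(μ * t)) * (μ * k t - k' t)) (Set.Ioi 0))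
    (hM : ∀ t, 0 ≤ t → ‖k t‖ ≤ M * Real.exp (ω * t)) (hμ : ω < μ.re) :
    ∫ t in Set.Ioi (0 : ℝ), exp (-(μ * t)) * (μ * k t - k' t) = k 0 := by
  have hderiv : ∀ t ∈ Set.Ici (0 : ℝ), HasDerivAt (fun t : ℝ => -(exp (-(μ * t)) * k t))
      (exp (-(μ * t)) * (μ * k t - k' t)) t := fun t ht => by
    have hexp : HasDerivAt (fun t : ℝ => exp (-(μ * t))) (exp (-(μ * t)) * -μ) t :=
      (hasDerivAt_const_mul μ).neg.cexp.comp_ofReal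
    exact (hexp.mul (hk t ht)).neg.congr_deriv (by ring)
  have hlim : Filter.Tendsto (fun t : ℝ => -(exp (-(μ * t)) * k t)) Filter.atTop (𝓝 0) := by
    have hexp : Filter.Tendsto (fun t : ℝ => M * Real.exp ((ω - μ.re) * t)) Filter.atTop (𝓝 0) := by
      simpa using (Real.tendsto_exp_atBot.comp
        (Filter.tendsto_id.const_mul_atTop_of_neg (sub_neg.2 hμ))).const_mul M
    refine squeeze_zero_norm' ?_ hexp
    filter_upwards [Filter.eventually_ge_atTop 0] with t ht
    rw [norm_neg]
    exact norm_exp_neg_mul_smul_le (hM t ht)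
  rw [integral_Ioi_of_hasDerivAt_of_tendsto' hderiv hint hlim]
  simp

end LaplaceTransform

section Orbit

variable {H : Type*} [NormedAddCommGroup H] [InnerProductSpace ℂ H] {T : ℝ → H →ₗ.[ℂ] H}
  {x y : H} {u v : ℝ → H} {ω ω' M : ℝ} {μ : ℂ}

/-- `u` is the orbit `t ↦ T(t)x` of a regular vector `x`. The graphs of the `T(t)` express both the
values and the membership in the domains; no value is prescribed for `t < 0`. -/
structure IsOrbit (T : ℝ → H →ₗ.[ℂ] H) (x : H) (u : ℝ → H) : Prop where
  mem_graph : ∀ t, 0 ≤ t → (x, u t) ∈ (T t).graph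
  mem_graph_add : ∀ t s, 0 ≤ t → 0 ≤ s → (u s, u (t + s)) ∈ (T t).graph
  continuousOn : ContinuousOn u (Set.Ioi 0)
  tendsto_zero : Filter.Tendsto u (𝓝[>] 0) (𝓝 x)

namespace IsOrbit

theorem opApply_eq (h : IsOrbit T x u) {t : ℝ} (ht : 0 ≤ t) : opApply (T t) x = u t :=
  (mem_graph_iff_opApply.1 (h.mem_graph t ht)).2

theorem of_continuousOn_Ici (hu : ContinuousOn u (Set.Ici 0))
    (h : ∀ t s, 0 ≤ t → 0 ≤ s → (u s, u (t + s)) ∈ (T t).graph) : IsOrbit T (u 0) u where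
  mem_graph t ht := by simpa using h t 0 ht le_rfl
  mem_graph_add := h
  continuousOn := hu.mono Set.Ioi_subset_Ici_self
  tendsto_zero := (hu 0 Set.self_mem_Ici).tendsto.mono_left
    (nhdsWithin_mono 0 Set.Ioi_subset_Ici_self)

theorem zero (T : ℝ → H →ₗ.[ℂ] H) : IsOrbit T 0 fun _ => 0 :=
  of_continuousOn_Ici continuousOn_const fun t _ _ _ => (T t).graph.zero_mem

theorem add (hx : IsOrbit T x u) (hy : IsOrbit T y v) :
    IsOrbit T (x + y) fun t => u t + v t where
  mem_graph t ht := (T t).graph.add_mem (hx.mem_graph t ht) (hy.mem_graph t ht)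
  mem_graph_add t s ht hs :=
    (T t).graph.add_mem (hx.mem_graph_add t s ht hs) (hy.mem_graph_add t s ht hs)
  continuousOn := hx.continuousOn.add hy.continuousOn
  tendsto_zero := hx.tendsto_zero.add hy.tendsto_zero

theorem smul (c : ℂ) (hx : IsOrbit T x u) : IsOrbit T (c • x) fun t => c • u t where
  mem_graph t ht := (T t).graph.smul_mem c (hx.mem_graph t ht)
  mem_graph_add t s ht hs := (T t).graph.smul_mem c (hx.mem_graph_add t s ht hs)
  continuousOn := hx.continuousOn.const_smul c
  tendsto_zero := hx.tendsto_zero.const_smul c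

theorem map_conj {S : ℝ → H →ₗ.[ℂ] H} {C : Conjugation H}
    (hS : ∀ t, 0 ≤ t → S t = C.conjOp (T t)) (hx : IsOrbit T x u) :
    IsOrbit S (C x) fun t => C (u t) where
  mem_graph t ht := by
    simpa only [hS t ht, C.mem_graph_conjOp, C.apply_apply] using hx.mem_graph t ht
  mem_graph_add t s ht hs := by
    simpa only [hS t ht, C.mem_graph_conjOp, C.apply_apply] using hx.mem_graph_add t s ht hs
  continuousOn := C.continuous.comp_continuousOn hx.continuousOn
  tendsto_zero := (C.continuous.tendsto x).comp hx.tendsto_zero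

theorem laplace_eq (h : IsOrbit T x u) (μ : ℂ) :
    laplace T μ x = ∫ t in Set.Ioi (0 : ℝ), exp (-(μ * t)) • u t :=
  setIntegral_congr_fun measurableSet_Ioi fun t ht => by
    simp only [h.opApply_eq (le_of_lt ht)]

theorem laplaceShift_zero (h : IsOrbit T x u) (μ : ℂ) : laplaceShift μ u 0 = laplace T μ x := by
  simp only [h.laplace_eq, laplaceShift, zero_add]

end IsOrbit

theorem mem_regularVectors_iff : x ∈ regularVectors T ↔ ∃ u, IsOrbit T x u := by
  constructor
  · rintro ⟨hdom, hlaw, hcont, hlim⟩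
    refine ⟨fun t => opApply (T t) x, fun t ht => ?_, fun t s ht hs => ?_, hcont,
      tendsto_iff_norm_sub_tendsto_zero.2 hlim⟩
    · exact mem_graph_iff_opApply.2 ⟨(hdom 0 t le_rfl ht).1, rfl⟩
    · exact mem_graph_iff_opApply.2 ⟨(hdom t s ht hs).2, hlaw t s ht hs⟩
  · rintro ⟨u, hu⟩
    have hgraph := fun t s ht hs => mem_graph_iff_opApply.1 (hu.mem_graph_add t s ht hs)
    refine ⟨fun t s ht hs => ⟨LinearPMap.mem_domain_of_mem_graph (hu.mem_graph s hs), ?_⟩,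
      fun t s ht hs => ?_, hu.continuousOn.congr fun t ht => hu.opApply_eq (le_of_lt ht), ?_⟩
    · rw [hu.opApply_eq hs]
      exact (hgraph t s ht hs).1
    · rw [hu.opApply_eq hs, hu.opApply_eq (add_nonneg ht hs)]
      exact (hgraph t s ht hs).2
    · refine (tendsto_iff_norm_sub_tendsto_zero.1 hu.tendsto_zero).congr' ?_
      filter_upwards [self_mem_nhdsWithin] with t ht
      rw [hu.opApply_eq (le_of_lt ht)]

theorem mem_sigmaSpace_iff : x ∈ sigmaSpace T ω ↔
    ∃ u M, IsOrbit T x u ∧ ∀ t, 0 ≤ t → ‖u t‖ ≤ M * Real.exp (ω * t) := by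
  have exp_mul_le_iff : ∀ t r M : ℝ,
      Real.exp (-(ω * t)) * r ≤ M ↔ r ≤ M * Real.exp (ω * t) := fun t r M => by
    rw [Real.exp_neg, inv_mul_le_iff₀ (Real.exp_pos _), mul_comm]
  simp only [sigmaSpace, Set.mem_ofPred_eq, mem_regularVectors_iff, bddAbove_def,
    Set.forall_mem_image, exp_mul_le_iff]
  constructor
  · rintro ⟨⟨u, hu⟩, M, hM⟩
    exact ⟨u, M, hu, fun t ht => hu.opApply_eq ht ▸ hM ht⟩
  · rintro ⟨u, M, hu, hM⟩
    exact ⟨⟨u, hu⟩, M, fun t ht => (hu.opApply_eq ht).symm ▸ hM t ht⟩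

/-- The linear space `Σ_ω`. -/
def sigmaSubmodule (T : ℝ → H →ₗ.[ℂ] H) (ω : ℝ) : Submodule ℂ H where
  carrier := sigmaSpace T ω
  zero_mem' := mem_sigmaSpace_iff.2 ⟨_, 0, .zero T, by simp⟩
  add_mem' hx hy := by
    obtain ⟨u, M, hu, hM⟩ := mem_sigmaSpace_iff.1 hx
    obtain ⟨v, N, hv, hN⟩ := mem_sigmaSpace_iff.1 hy
    refine mem_sigmaSpace_iff.2 ⟨_, M + N, hu.add hv, fun t ht => ?_⟩
    rw [add_mul]
    exact norm_add_le_of_le (hM t ht) (hN t ht)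
  smul_mem' c x hx := by
    obtain ⟨u, M, hu, hM⟩ := mem_sigmaSpace_iff.1 hx
    refine mem_sigmaSpace_iff.2 ⟨_, ‖c‖ * M, hu.smul c, fun t ht => ?_⟩
    rw [norm_smul, mul_assoc]
    exact mul_le_mul_of_nonneg_left (hM t ht) (norm_nonneg c)

theorem sigmaSpace_mono (h : ω ≤ ω') : sigmaSpace T ω ⊆ sigmaSpace T ω' := fun x hx => by
  obtain ⟨u, M, hu, hM⟩ := mem_sigmaSpace_iff.1 hx
  have hM0 : 0 ≤ M := by simpa using (norm_nonneg _).trans (hM 0 le_rfl)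
  refine mem_sigmaSpace_iff.2 ⟨u, M, hu, fun t ht => (hM t ht).trans ?_⟩
  gcongr

theorem mem_sigmaSpace_of_forall_exp_smul_mem_graph {η : ℂ}
    (h : ∀ t, 0 ≤ t → (x, exp (η * t) • x) ∈ (T t).graph) : x ∈ sigmaSpace T η.re := by
  set u : ℝ → H := fun t => exp (η * t) • x
  have hu : IsOrbit T (u 0) u :=
    .of_continuousOn_Ici (by fun_prop) fun t s ht _ => by
      have hexp : exp (η * (t + s : ℝ)) = exp (η * s) * exp (η * t) := by
        rw [← Complex.exp_add]; push_cast; ring_nf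
      simpa only [u, hexp, mul_smul] using! (T t).graph.smul_mem (exp (η * s)) (h t ht)
  have hu0 : u 0 = x := by simp [u]
  refine mem_sigmaSpace_iff.2 ⟨u, ‖x‖, hu0 ▸ hu, fun t _ => ?_⟩
  rw [norm_smul, norm_exp, re_mul_ofReal, mul_comm]

theorem IsOrbit.integrableOn (h : IsOrbit T x u) (hM : ∀ t, 0 ≤ t → ‖u t‖ ≤ M * Real.exp (ω * t))
    (hμ : ω < μ.re) : IntegrableOn (fun t : ℝ => exp (-(μ * t)) • u t) (Set.Ioi 0) :=
  integrableOn_exp_neg_mul_smul h.continuousOn hM hμ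

section Laplace

variable [CompleteSpace H] {C : Conjugation H}

theorem IsOrbit.isOrbit_laplaceShift (hT : ∀ t, 0 ≤ t → (T t).IsClosed)
    (h : IsOrbit T x u) (hM : ∀ t, 0 ≤ t → ‖u t‖ ≤ M * Real.exp (ω * t)) (hμ : ω < μ.re) :
    IsOrbit T (laplace T μ x) (laplaceShift μ u) := by
  have hint : ∀ s, 0 ≤ s →
      IntegrableOn (fun t : ℝ => exp (-(μ * t)) • u (s + t)) (Set.Ioi 0) := fun s hs =>
    integrableOn_exp_neg_mul_smul (continuousOn_comp_add h.continuousOn hs)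
      (norm_comp_add_le_mul_exp hM hs) hμ
  rw [← h.laplaceShift_zero]
  refine .of_continuousOn_Ici (continuousOn_laplaceShift (h.integrableOn hM hμ))
    fun t s ht hs => ?_
  refine integral_mem_graph (hT t ht) (hint s hs) (hint (t + s) (add_nonneg ht hs)) ?_
  filter_upwards [ae_restrict_mem measurableSet_Ioi] with r hr
  rw [add_assoc]
  exact (T t).graph.smul_mem _ (h.mem_graph_add t (s + r) ht (add_nonneg hs (le_of_lt hr)))

theorem laplace_mem_sigmaSpace (hT : ∀ t, 0 ≤ t → (T t).IsClosed)
    (hx : x ∈ sigmaSpace T ω) (hμ : ω < μ.re) : laplace T μ x ∈ sigmaSpace T ω := by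
  obtain ⟨u, M, hu, hM⟩ := mem_sigmaSpace_iff.1 hx
  exact mem_sigmaSpace_iff.2 ⟨_, _, hu.isOrbit_laplaceShift hT hM hμ, fun s hs =>
    norm_laplaceShift_le hM hμ hs⟩

theorem inner_laplace_comm
    (hT : ∀ t, 0 ≤ t → IsCSymmetric C (T t)) (hx : x ∈ sigmaSpace T ω) (hy : y ∈ sigmaSpace T ω)
    (hμ : ω < μ.re) : inner ℂ (C (laplace T μ x)) y = inner ℂ (C x) (laplace T μ y) := by
  obtain ⟨u, M, hu, hM⟩ := mem_sigmaSpace_iff.1 hx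
  obtain ⟨v, N, hv, hN⟩ := mem_sigmaSpace_iff.1 hy
  rw [C.inner_map_left, hu.laplace_eq, hv.laplace_eq, ← integral_inner (hu.integrableOn hM hμ),
    ← integral_inner (hv.integrableOn hN hμ)]
  refine setIntegral_congr_fun measurableSet_Ioi fun t ht => ?_
  have ht' : (0 : ℝ) ≤ t := le_of_lt ht
  simp only [inner_smul_right]
  rw [C.inner_map_left y, (hT t ht').inner_eq (hu.mem_graph t ht') (hv.mem_graph t ht')]

theorem isCSymmetric_of_forall_eq_laplace
    (hT : ∀ t, 0 ≤ t → IsCSymmetric C (T t)) {R : H →ₗ.[ℂ] H}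
    (hR : ∀ x : R.domain, ∃ ω : ℝ, ∀ μ : ℂ, ω < μ.re →
      μ • (x : H) - R x ∈ sigmaSpace T ω ∧ (x : H) = laplace T μ (μ • (x : H) - R x)) :
    IsCSymmetric C R := fun x y => by
  obtain ⟨ω₁, h₁⟩ := hR x
  obtain ⟨ω₂, h₂⟩ := hR y
  obtain ⟨μ, hμ⟩ : ∃ μ : ℂ, max ω₁ ω₂ < μ.re := ⟨(max ω₁ ω₂ + 1 : ℝ), by simp⟩
  obtain ⟨hu, hx⟩ := h₁ μ ((le_max_left _ _).trans_lt hμ)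
  obtain ⟨hv, hy⟩ := h₂ μ ((le_max_right _ _).trans_lt hμ)
  have h := inner_laplace_comm hT (sigmaSpace_mono (le_max_left _ _) hu)
    (sigmaSpace_mono (le_max_right _ _) hv) hμ
  rw [← hx, ← hy, C.map_sub, C.map_smul, inner_sub_left, inner_sub_right, inner_smul_left,
    inner_smul_right, conj_conj] at h
  exact sub_right_injective h

end Laplace

section Conjugate

variable {S : ℝ → H →ₗ.[ℂ] H} {C : Conjugation H}

theorem map_mem_sigmaSpace (hS : ∀ t, 0 ≤ t → S t = C.conjOp (T t)) (hx : x ∈ sigmaSpace T ω) :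
    C x ∈ sigmaSpace S ω := by
  obtain ⟨u, M, hu, hM⟩ := mem_sigmaSpace_iff.1 hx
  exact mem_sigmaSpace_iff.2 ⟨_, M, hu.map_conj hS, fun t ht => (C.norm_map _).trans_le (hM t ht)⟩

theorem laplace_conj (hS : ∀ t, 0 ≤ t → S t = C.conjOp (T t)) (hx : x ∈ regularVectors T)
    (μ : ℂ) : laplace S (conj μ) (C x) = C (laplace T μ x) := by
  obtain ⟨u, hu⟩ := mem_regularVectors_iff.1 hx
  rw [(hu.map_conj hS).laplace_eq, hu.laplace_eq, ← C.integral_comp]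
  simp only [C.map_smul, ← exp_conj, map_neg, map_mul, conj_ofReal]

theorem conj_symm (hS : ∀ t, 0 ≤ t → S t = C.conjOp (T t)) (t : ℝ) (ht : 0 ≤ t) :
    T t = C.conjOp (S t) := by
  rw [hS t ht, C.conjOp_conjOp]

theorem IsUnboundedC0Semigroup.map_conj (hS : ∀ t, 0 ≤ t → S t = C.conjOp (T t))
    (hT : IsUnboundedC0Semigroup T) : IsUnboundedC0Semigroup S := by
  obtain ⟨x, hx, hx0⟩ := hT
  obtain ⟨u, hu⟩ := mem_regularVectors_iff.1 hx
  refine ⟨C x, mem_regularVectors_iff.2 ⟨_, hu.map_conj hS⟩, ?_⟩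
  rwa [← norm_ne_zero_iff, C.norm_map, norm_ne_zero_iff]

theorem IsGenerator.map_conj {R : H →ₗ.[ℂ] H} (hS : ∀ t, 0 ≤ t → S t = C.conjOp (T t))
    (hR : IsGenerator T R) : IsGenerator S (C.conjOp R) := fun x z => by
  rw [C.mem_graph_conjOp, hR]
  constructor
  · rintro ⟨ω, μ, y, hμ, hy, hx, hz⟩
    refine ⟨ω, (starRingEnd ℂ) μ, C y, by rwa [conj_re], map_mem_sigmaSpace hS hy, ?_, ?_⟩
    · rw [laplace_conj hS hy.1, ← hx, C.apply_apply]
    · rw [← C.apply_apply z, hz, C.map_sub, C.map_smul, C.apply_apply]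
  · rintro ⟨ω, μ, y, hμ, hy, rfl, rfl⟩
    have hT := conj_symm hS
    refine ⟨ω, (starRingEnd ℂ) μ, C y, by rwa [conj_re], map_mem_sigmaSpace hT hy, ?_, ?_⟩
    · rw [laplace_conj hT hy.1]
    · rw [C.map_sub, C.map_smul]

theorem not_isGenerator_adjoint [CompleteSpace H] {R : H →ₗ.[ℂ] H}
    (hS : ∀ t, 0 ≤ t → S t = C.conjOp (T t)) (hR : IsGenerator T R)
    (hd : Dense (R.domain : Set H)) (hn : ¬ IsCSelfAdjoint C R) : ¬ IsGenerator S R.adjoint :=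
  fun h => hn ⟨hd, by rw [h.unique (hR.map_conj hS), C.conjOp_conjOp]⟩

end Conjugate

end Orbit

section WeightedFlow

/-- Point evaluation as a continuous linear functional on the Fock space. -/
def Fock.evalCLM (z : ℂ) : Fock →L[ℂ] ℂ :=
  LinearMap.mkContinuous
    { toFun := fun f => f z
      map_add' := fun _ _ => rfl
      map_smul' := fun _ _ => rfl } (Real.exp (‖z‖ ^ 2 / 2)) fun f => f.norm_apply_le z

theorem Fock.evalCLM_apply (z : ℂ) (f : Fock) : Fock.evalCLM z f = f z := rfl

theorem apply_eq_of_mem_graph_of_le_wcMax {A : Fock →ₗ.[ℂ] Fock} {ψ φ : ℂ → ℂ} {f g : Fock}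
    (hA : A ≤ wcMax ψ φ) (h : (f, g) ∈ A.graph) (z : ℂ) : g z = ψ z * f (φ z) := by
  obtain ⟨f, rfl, rfl⟩ := (LinearPMap.mem_graph_iff _).1 (LinearPMap.le_graph_of_le hA h)
  rfl

/-- The first-order differential expression `p f + F f'`. -/
def diffExpr (p F : ℂ → ℂ) (f : Fock) (z : ℂ) : ℂ := p z * f z + F z * deriv f z

theorem diffExpr_add (p F : ℂ → ℂ) (f g : Fock) :
    diffExpr p F (f + g) = diffExpr p F f + diffExpr p F g := by
  ext z
  have h : deriv (f + g : Fock) z = deriv f z + deriv g z :=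
    deriv_add f.differentiable.differentiableAt g.differentiable.differentiableAt
  simp only [diffExpr, Fock.add_apply, Pi.add_apply, h]
  ring

theorem diffExpr_smul (p F : ℂ → ℂ) (c : ℂ) (f : Fock) :
    diffExpr p F (c • f) = c • diffExpr p F f := by
  ext z
  have h : deriv (c • f : Fock) z = c * deriv f z :=
    deriv_const_mul c f.differentiable.differentiableAt
  simp only [diffExpr, Fock.smul_apply, Pi.smul_apply, smul_eq_mul, h]
  ring

/-- The operator `f ↦ p f + F f'` on the union over `ω` of the sets of all `f ∈ Σ_ω` whose image
lies in `Σ_ω`. -/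
def diffOp (p F : ℂ → ℂ) (T : ℝ → Fock →ₗ.[ℂ] Fock) : Fock →ₗ.[ℂ] Fock where
  domain :=
    { carrier := {f | ∃ ω, f ∈ sigmaSpace T ω ∧ ∃ g ∈ sigmaSpace T ω, ∀ z, g z = diffExpr p F f z}
      zero_mem' := by
        refine ⟨0, (sigmaSubmodule T 0).zero_mem, 0, (sigmaSubmodule T 0).zero_mem, fun z => ?_⟩
        simpa using (congrFun (diffExpr_smul p F 0 0) z).symm
      add_mem' := by
        rintro f₁ f₂ ⟨ω₁, hf₁, g₁, hg₁, h₁⟩ ⟨ω₂, hf₂, g₂, hg₂, h₂⟩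
        have hle₁ : sigmaSpace T ω₁ ⊆ sigmaSubmodule T (max ω₁ ω₂) :=
          sigmaSpace_mono (le_max_left _ _)
        have hle₂ : sigmaSpace T ω₂ ⊆ sigmaSubmodule T (max ω₁ ω₂) :=
          sigmaSpace_mono (le_max_right _ _)
        refine ⟨_, Submodule.add_mem _ (hle₁ hf₁) (hle₂ hf₂), _,
          Submodule.add_mem _ (hle₁ hg₁) (hle₂ hg₂), fun z => ?_⟩
        rw [diffExpr_add, Pi.add_apply, Fock.add_apply, h₁, h₂]
      smul_mem' := by
        rintro c f ⟨ω, hf, g, hg, h⟩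
        refine ⟨ω, (sigmaSubmodule T ω).smul_mem c hf, _, (sigmaSubmodule T ω).smul_mem c hg,
          fun z => ?_⟩
        rw [diffExpr_smul, Pi.smul_apply, Fock.smul_apply, h, smul_eq_mul] }
  toFun :=
    { toFun := fun f => Fock.mk (diffExpr p F f) <| by
        obtain ⟨-, -, g, -, hg⟩ := f.2
        rw [← funext hg]
        exact ⟨g.differentiable, g.memLp⟩
      map_add' := fun f g => Fock.ext (congrFun (diffExpr_add p F f g))
      map_smul' := fun c f => Fock.ext (congrFun (diffExpr_smul p F c f)) }

theorem coe_domain_diffOp (p F : ℂ → ℂ) (T : ℝ → Fock →ₗ.[ℂ] Fock) :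
    ((diffOp p F T).domain : Set Fock) =
      ⋃ ω, {f | f ∈ sigmaSpace T ω ∧ ∃ g ∈ sigmaSpace T ω, ∀ z, g z = diffExpr p F f z} := by
  ext f
  rw [Set.mem_iUnion]
  rfl

/-- `φ` is the flow of the vector field `F`, and `ψ` solves `∂ψ/∂t = ψ · (p ∘ φ)`, `ψ₀ = 1`: the
weighted composition operators `f ↦ ψ_t · f ∘ φ_t` formally have the generator `f ↦ p f + F f'`. -/
structure IsWeightedFlow (ψ φ : ℝ → ℂ → ℂ) (p F : ℂ → ℂ) : Prop where
  flow_zero : ∀ z, φ 0 z = z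
  weight_zero : ∀ z, ψ 0 z = 1
  hasDerivAt_flow : ∀ t z, 0 ≤ t → HasDerivAt (fun t => φ t z) (F (φ t z)) t
  hasDerivAt_weight : ∀ t z, 0 ≤ t → HasDerivAt (fun t => ψ t z) (ψ t z * p (φ t z)) t

namespace IsWeightedFlow

variable {ψ φ : ℝ → ℂ → ℂ} {p F : ℂ → ℂ} {T : ℝ → Fock →ₗ.[ℂ] Fock}

theorem hasDerivAt_mul_comp (h : IsWeightedFlow ψ φ p F) (f : Fock) {t : ℝ} (ht : 0 ≤ t) (z : ℂ) :
    HasDerivAt (fun t => ψ t z * f (φ t z)) (ψ t z * diffExpr p F f (φ t z)) t := by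
  have hf : HasDerivAt (fun t => f (φ t z)) (deriv f (φ t z) * F (φ t z)) t :=
    f.differentiable.differentiableAt.hasDerivAt.comp t (h.hasDerivAt_flow t z ht)
  refine ((h.hasDerivAt_weight t z ht).mul hf).congr_deriv ?_
  rw [diffExpr]
  ring

theorem laplace_smul_sub_eq (h : IsWeightedFlow ψ φ p F)
    (hT : ∀ t, 0 ≤ t → T t ≤ wcMax (ψ t) (φ t)) {ω : ℝ} {μ : ℂ} {f g : Fock}
    (hf : f ∈ sigmaSpace T ω) (hg : g ∈ sigmaSpace T ω) (hfg : ∀ z, g z = diffExpr p F f z)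
    (hμ : ω < μ.re) : laplace T μ (μ • f - g) = f := by
  obtain ⟨u, M, hu, hM⟩ := mem_sigmaSpace_iff.1 hf
  obtain ⟨v, N, hv, hN⟩ := mem_sigmaSpace_iff.1 hg
  have hμu_v : IsOrbit T (μ • f - g) fun t => μ • u t - v t := by
    simpa [sub_eq_add_neg] using (hu.smul μ).add (hv.smul (-1))
  have hint : IntegrableOn (fun t : ℝ => exp (-(μ * t)) • (μ • u t - v t)) (Set.Ioi 0) := by
    refine (((hu.integrableOn hM hμ).smul μ).sub (hv.integrableOn hN hμ)).congr
      (.of_forall fun t => ?_)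
    simp only [Pi.sub_apply, Pi.smul_apply, smul_sub, smul_comm μ]
  ext z
  have hk : ∀ t, 0 ≤ t → ψ t z * f (φ t z) = u t z := fun t ht =>
    (apply_eq_of_mem_graph_of_le_wcMax (hT t ht) (hu.mem_graph t ht) z).symm
  have hk' : ∀ t, 0 ≤ t → ψ t z * diffExpr p F f (φ t z) = v t z := fun t ht => by
    rw [← hfg, ← apply_eq_of_mem_graph_of_le_wcMax (hT t ht) (hv.mem_graph t ht) z]
  have hintegrand : Set.EqOn (fun t : ℝ => Fock.evalCLM z (exp (-(μ * t)) • (μ • u t - v t)))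
      (fun t : ℝ => exp (-(μ * t)) *
        (μ * (ψ t z * f (φ t z)) - ψ t z * diffExpr p F f (φ t z))) (Set.Ioi 0) := fun t ht => by
    simp only [hk t (le_of_lt ht), hk' t (le_of_lt ht)]
    rfl
  have hint' := IntegrableOn.congr_fun ((Fock.evalCLM z).integrable_comp hint) hintegrand
    measurableSet_Ioi
  have hbound : ∀ t, 0 ≤ t → ‖ψ t z * f (φ t z)‖ ≤ ‖Fock.evalCLM z‖ * M * Real.exp (ω * t) :=
    fun t ht => by
      rw [hk t ht, mul_assoc]
      exact (Fock.evalCLM z).le_opNorm_of_le (hM t ht)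
  rw [hμu_v.laplace_eq, ← Fock.evalCLM_apply, ← (Fock.evalCLM z).integral_comp_comm hint,
    setIntegral_congr_fun measurableSet_Ioi hintegrand,
    integral_exp_neg_mul_mul_sub (fun t ht => h.hasDerivAt_mul_comp f ht z) hint' hbound hμ,
    h.flow_zero, h.weight_zero, one_mul]

theorem diffExpr_laplace (h : IsWeightedFlow ψ φ p F)
    (hT : ∀ t, 0 ≤ t → T t ≤ wcMax (ψ t) (φ t)) (hc : ∀ t, 0 ≤ t → (T t).IsClosed) {ω : ℝ} {μ : ℂ}
    {y : Fock} (hy : y ∈ sigmaSpace T ω) (hμ : ω < μ.re) (z : ℂ) :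
    diffExpr p F (laplace T μ y) z = (μ • laplace T μ y - y) z := by
  obtain ⟨u, M, hu, hM⟩ := mem_sigmaSpace_iff.1 hy
  have horbit := hu.isOrbit_laplaceShift hc hM hμ
  have hderiv := ((Fock.evalCLM z).restrictScalars ℝ).hasFDerivAt.comp_hasDerivWithinAt 0
    (hasDerivWithinAt_laplaceShift_zero (hu.integrableOn hM hμ) hu.tendsto_zero)
  have hderiv' := ((h.hasDerivAt_mul_comp (laplace T μ y) le_rfl z).hasDerivWithinAt
    (s := Set.Ici 0)).congr_of_mem (fun t ht =>
      apply_eq_of_mem_graph_of_le_wcMax (hT t ht) (horbit.mem_graph t ht) z) Set.self_mem_Ici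
  rw [h.flow_zero, h.weight_zero, one_mul] at hderiv'
  rw [← hu.laplaceShift_zero μ] at hderiv' ⊢
  exact (uniqueDiffOn_Ici 0 0 Set.self_mem_Ici).eq_deriv _ hderiv' hderiv

theorem isGenerator_diffOp (h : IsWeightedFlow ψ φ p F)
    (hT : ∀ t, 0 ≤ t → T t ≤ wcMax (ψ t) (φ t)) (hc : ∀ t, 0 ≤ t → (T t).IsClosed) :
    IsGenerator T (diffOp p F T) := fun x z => by
  rw [LinearPMap.mem_graph_iff]
  constructor
  · rintro ⟨⟨f, ω, hf, g, hg, hfg⟩, rfl, rfl⟩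
    have hμ : ω < ((ω + 1 : ℝ) : ℂ).re := by simp
    refine ⟨ω, _, _, hμ, (sigmaSubmodule T ω).sub_mem ((sigmaSubmodule T ω).smul_mem _ hf) hg,
      (h.laplace_smul_sub_eq hT hf hg hfg hμ).symm, ?_⟩
    rw [sub_sub_cancel]
    exact Fock.ext fun z => (hfg z).symm
  · rintro ⟨ω, μ, y, hμ, hy, rfl, rfl⟩
    have hx := laplace_mem_sigmaSpace hc hy hμ
    have hdiff := h.diffExpr_laplace hT hc hy hμ
    exact ⟨⟨_, ω, hx, _, (sigmaSubmodule T ω).sub_mem ((sigmaSubmodule T ω).smul_mem μ hx) hy,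
      fun z => (hdiff z).symm⟩, rfl, Fock.ext hdiff⟩

theorem isCSymmetric_diffOp {C : Conjugation Fock} (h : IsWeightedFlow ψ φ p F)
    (hT : ∀ t, 0 ≤ t → T t ≤ wcMax (ψ t) (φ t)) (hs : ∀ t, 0 ≤ t → IsCSymmetric C (T t)) :
    IsCSymmetric C (diffOp p F T) := by
  refine isCSymmetric_of_forall_eq_laplace hs ?_
  rintro ⟨f, ω, hf, g, hg, hfg⟩
  refine ⟨ω, fun μ hμ => ?_⟩
  have hval : diffOp p F T ⟨f, ω, hf, g, hg, hfg⟩ = g := Fock.ext fun z => (hfg z).symm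
  rw [hval]
  exact ⟨(sigmaSubmodule T ω).sub_mem ((sigmaSubmodule T ω).smul_mem μ hf) hg,
    (h.laplace_smul_sub_eq hT hf hg hfg hμ).symm⟩

end IsWeightedFlow
end WeightedFlow

section PointSpectrum

variable {ℓ G η : ℂ}

theorem sub_mul_deriv_pow_mul {g : ℂ → ℂ} {z : ℂ} (w : ℂ) (n : ℕ) (hg : DifferentiableAt ℂ g z) :
    (z - w) * deriv (fun z => (z - w) ^ n * g z) z =
      (z - w) ^ n * (n * g z + (z - w) * deriv g z) := by
  have hpow : HasDerivAt (fun z : ℂ => (z - w) ^ n) (n * (z - w) ^ (n - 1)) z := by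
    simpa using ((hasDerivAt_id z).sub_const w).fun_pow n
  have hn : (z - w) * (n * (z - w) ^ (n - 1)) = n * (z - w) ^ n := by
    rcases n with _ | n
    · simp
    · rw [Nat.add_sub_cancel, pow_succ]; ring
  rw [(hpow.fun_mul hg.hasDerivAt).deriv]
  linear_combination g z * hn

/-- Comparing the leading terms of the factorisation `f = (z - G)ᵏ g` with `g G ≠ 0`. -/
theorem exists_eq_add_natCast_mul_of_eigenfunction {f p : ℂ → ℂ} (hf : AnalyticAt ℂ f G)
    (hf_ne : ¬ ∀ᶠ z in 𝓝 G, f z = 0) (hp : ContinuousAt p G)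
    (h : ∀ᶠ z in 𝓝 G, p z * f z + ℓ * (z - G) * deriv f z = η * f z) :
    ∃ k : ℕ, η = p G + k * ℓ := by
  obtain ⟨k, g, hg, hg_ne, hfg⟩ := hf.exists_eventuallyEq_pow_smul_nonzero_iff.2 hf_ne
  simp only [smul_eq_mul] at hfg
  have hfactor : ∀ᶠ z in 𝓝[≠] G, (p z + k * ℓ - η) * g z + ℓ * (z - G) * deriv g z = 0 := by
    filter_upwards [h.filter_mono nhdsWithin_le_nhds,
      hfg.eventually_nhds.filter_mono nhdsWithin_le_nhds,
      hg.eventually_analyticAt.filter_mono nhdsWithin_le_nhds, self_mem_nhdsWithin]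
      with z hz hfz hgz hzG
    have hderiv := sub_mul_deriv_pow_mul G k hgz.differentiableAt
    rw [hfz.self_of_nhds, Filter.EventuallyEq.deriv_eq hfz] at hz
    refine (mul_eq_zero.1 ?_).resolve_left (pow_ne_zero k (sub_ne_zero.2 hzG))
    linear_combination hz - ℓ * hderiv
  have hcont : ContinuousAt (fun z => (p z + k * ℓ - η) * g z + ℓ * (z - G) * deriv g z) G := by
    have hg_cont := hg.continuousAt
    have hg'_cont := hg.deriv.continuousAt
    fun_prop
  have hG := tendsto_nhds_unique (hcont.tendsto.mono_left nhdsWithin_le_nhds)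
    (tendsto_const_nhds.congr' (hfactor.mono fun _ hz => hz.symm))
  rw [sub_self, mul_zero, zero_mul, add_zero] at hG
  exact ⟨k, (sub_eq_zero.1 ((mul_eq_zero.1 hG).resolve_right hg_ne)).symm⟩

theorem pointSpectrum_diffOp_subset {p : ℂ → ℂ} (hp : ContinuousAt p G)
    (T : ℝ → Fock →ₗ.[ℂ] Fock) :
    pointSpectrum (diffOp p (fun z => ℓ * (z - G)) T) ⊆ {η | ∃ k : ℕ, η = p G + k * ℓ} := by
  rintro η ⟨f, hf_ne, hf⟩
  have hentire : AnalyticOnNhd ℂ (f : Fock) Set.univ :=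
    (f : Fock).differentiable.differentiableOn.analyticOnNhd isOpen_univ
  refine exists_eq_add_natCast_mul_of_eigenfunction (hentire G trivial) (fun hzero => hf_ne ?_) hp
    (.of_forall fun z => congr($hf z))
  exact DFunLike.coe_injective (hentire.eq_of_eventuallyEq (g := 0) analyticOnNhd_const hzero)

end PointSpectrum

section Semiflow

variable {a b ℓ G H : ℂ}

theorem hasDerivAt_exp_mul_ofReal (ℓ : ℂ) (t : ℝ) :
    HasDerivAt (fun t : ℝ => exp (ℓ * t)) (ℓ * exp (ℓ * t)) t := by
  simpa [mul_comm] using (ofRealCLM.hasDerivAt.const_mul ℓ).cexp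

theorem hasDerivAt_semiflow (t : ℝ) (z : ℂ) :
    HasDerivAt (fun t => semiflow ℓ G t z) (ℓ * (semiflow ℓ G t z - G)) t := by
  have hexp := hasDerivAt_exp_mul_ofReal ℓ t
  refine ((hexp.mul_const z).add ((hexp.const_sub 1).const_mul G)).congr_deriv ?_
  simp only [semiflow]
  ring

theorem hasDerivAt_semicocycle (t : ℝ) (z : ℂ) :
    HasDerivAt (fun t => semicocycle a b ℓ G H t z)
      (semicocycle a b ℓ G H t z * (H - ℓ * (a * G + b) * semiflow ℓ G t z)) t := by
  have hid : HasDerivAt (fun t : ℝ => (t : ℂ)) 1 t := ofRealCLM.hasDerivAt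
  have hexp := hasDerivAt_exp_mul_ofReal ℓ t
  have hconst := ((hid.const_mul H).add
    (((hexp.sub (hid.const_mul ℓ)).sub_const 1).const_mul (G * (a * G + b)))).cexp
  have hlinear := (((hexp.const_sub 1).const_mul (a * G + b)).const_mul z).cexp
  refine (hconst.mul hlinear).congr_deriv ?_
  simp only [semiflow, semicocycle, Pi.add_apply, Pi.sub_apply]
  ring

theorem isWeightedFlow_semiflow : IsWeightedFlow (semicocycle a b ℓ G H) (semiflow ℓ G)
    (fun z => H - ℓ * (a * G + b) * z) fun z => ℓ * (z - G) where
  flow_zero z := by simp [semiflow]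
  weight_zero z := by simp [semicocycle]
  hasDerivAt_flow t z _ := hasDerivAt_semiflow t z
  hasDerivAt_weight t z _ := hasDerivAt_semicocycle t z

theorem differentiable_semiflow (t : ℝ) : Differentiable ℂ (semiflow ℓ G t) := by
  unfold semiflow
  fun_prop

theorem differentiable_semicocycle (t : ℝ) : Differentiable ℂ (semicocycle a b ℓ G H t) := by
  unfold semicocycle
  fun_prop

end Semiflow

section ExpPolynomials

theorem integrable_exp_sq_norm_div_two :
    Integrable (fun z : ℂ => Real.exp (‖z‖ ^ 2 / 2)) gaussian := by
  have h : Integrable fun z : ℂ => Real.exp (-(1 / 2) * ‖z‖ ^ 2) :=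
    .of_integral_ne_zero <| by
      rw [GaussianFourier.integral_rexp_neg_mul_sq_norm (by norm_num)]
      positivity
  refine (Fock.integrable_gaussian _).2 ((h.const_mul Real.pi⁻¹).congr (.of_forall fun z => ?_))
  simp only [smul_eq_mul, mul_assoc, ← Real.exp_add]
  ring_nf

theorem memLp_exp_mul_norm_sub (r : ℝ) (w : ℂ) :
    MemLp (fun z : ℂ => Real.exp (r * ‖z - w‖)) 2 gaussian := by
  rw [memLp_two_iff_integrable_sq (by fun_prop)]
  refine (integrable_exp_sq_norm_div_two.const_mul (Real.exp (4 * r ^ 2 + ‖w‖ ^ 2 / 2))).mono'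
    (by fun_prop) (.of_forall fun z => ?_)
  rw [Real.norm_of_nonneg (by positivity), ← Real.exp_nat_mul, ← Real.exp_add, Real.exp_le_exp]
  push_cast
  have hsq : ‖z - w‖ ^ 2 ≤ (‖z‖ + ‖w‖) ^ 2 := by gcongr; exact norm_sub_le z w
  nlinarith [sq_nonneg (4 * r - ‖z - w‖), sq_nonneg (‖z‖ - ‖w‖)]

theorem memFock_of_norm_le {f : ℂ → ℂ} (hf : Differentiable ℂ f) {M r : ℝ} {w : ℂ}
    (h : ∀ z, ‖f z‖ ≤ M * Real.exp (r * ‖z - w‖)) : MemFock f :=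
  ⟨hf, ((memLp_exp_mul_norm_sub r w).const_mul M).mono' hf.continuous.aestronglyMeasurable
    (.of_forall h)⟩

theorem exists_norm_le_mul_of_norm_apply_le (r : ℝ) (w : ℂ) : ∃ K, ∀ (f : Fock) (M : ℝ), 0 ≤ M →
    (∀ z, ‖f z‖ ≤ M * Real.exp (r * ‖z - w‖)) → ‖f‖ ≤ M * K := by
  refine ⟨√(∫ z, Real.exp (r * ‖z - w‖) ^ 2 ∂gaussian), fun f M hM hf => ?_⟩
  rw [← abs_of_nonneg hM, ← Real.sqrt_sq_eq_abs, ← Real.sqrt_mul (sq_nonneg M)]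
  refine Real.le_sqrt_of_sq_le ?_
  rw [Fock.norm_sq_eq, ← integral_const_mul]
  refine integral_mono f.memLp.integrable_norm_pow'
    ((memLp_exp_mul_norm_sub r w).integrable_sq.const_mul _) fun z => ?_
  simp only [← mul_pow]
  gcongr
  exact hf z

theorem norm_pow_mul_exp_mul_le (U x : ℂ) (k : ℕ) :
    ‖x ^ k * exp (U * x)‖ ≤ k.factorial * Real.exp ((‖U‖ + 1) * ‖x‖) := by
  have hpow : ‖x‖ ^ k ≤ k.factorial * Real.exp ‖x‖ := by
    rw [← div_le_iff₀' (by positivity)]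
    exact Real.pow_div_factorial_le_exp _ (norm_nonneg x) k
  have hexp : ‖exp (U * x)‖ ≤ Real.exp (‖U‖ * ‖x‖) := by
    rw [← norm_mul]
    exact norm_exp_le_exp_norm _
  calc ‖x ^ k * exp (U * x)‖ ≤ (k.factorial * Real.exp ‖x‖) * Real.exp (‖U‖ * ‖x‖) := by
        rw [norm_mul, norm_pow]
        gcongr
    _ = k.factorial * Real.exp ((‖U‖ + 1) * ‖x‖) := by
        rw [mul_assoc, ← Real.exp_add]
        ring_nf

/-- The function `(z - w)ᵏ e^{U(z - w)}`. It is the `k`-th derivative in `U` of its case `k = 0`,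
and that case is a multiple of the reproducing kernel at `conj U`. -/
def expPoly (w : ℂ) (k : ℕ) (U : ℂ) : Fock :=
  Fock.mk (fun z => (z - w) ^ k * exp (U * (z - w)))
    (memFock_of_norm_le (by fun_prop) fun z => norm_pow_mul_exp_mul_le U (z - w) k)

theorem expPoly_apply (w : ℂ) (k : ℕ) (U z : ℂ) :
    expPoly w k U z = (z - w) ^ k * exp (U * (z - w)) := rfl

theorem norm_taylor_remainder_exp_mul_le {ε : ℂ} (hε : ‖ε‖ ≤ 1) (U x : ℂ) (k : ℕ) :
    ‖x ^ k * exp ((U + ε) * x) - x ^ k * exp (U * x) - ε * (x ^ (k + 1) * exp (U * x))‖ ≤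
      ‖ε‖ ^ 2 * (k + 2).factorial * Real.exp ((‖U‖ + 1 + 1) * ‖x‖) := by
  have hremainder : ‖exp (ε * x) - 1 - ε * x‖ ≤ ‖ε * x‖ ^ 2 * Real.exp ‖x‖ := by
    have h := norm_exp_sub_sum_le_norm_mul_exp (ε * x) 2
    simp only [Finset.sum_range_succ, Finset.sum_range_zero, pow_zero, pow_one, zero_add,
      Nat.factorial_zero, Nat.factorial_one, Nat.cast_one, div_one, ← sub_sub] at h
    refine h.trans ?_
    gcongr
    rw [norm_mul]
    exact mul_le_of_le_one_left (norm_nonneg x) hε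
  calc _ = ‖x ^ k * exp (U * x) * (exp (ε * x) - 1 - ε * x)‖ := by
        rw [add_mul, Complex.exp_add]
        ring_nf
    _ ≤ ‖x ^ k * exp (U * x)‖ * (‖ε * x‖ ^ 2 * Real.exp ‖x‖) := by
        rw [norm_mul]
        gcongr
    _ = ‖ε‖ ^ 2 * ‖x ^ (k + 2) * exp (U * x)‖ * Real.exp ‖x‖ := by
        simp only [norm_mul, norm_pow]
        ring
    _ ≤ ‖ε‖ ^ 2 * ((k + 2).factorial * Real.exp ((‖U‖ + 1) * ‖x‖)) * Real.exp ‖x‖ := by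
        gcongr
        exact norm_pow_mul_exp_mul_le U x (k + 2)
    _ = ‖ε‖ ^ 2 * (k + 2).factorial * Real.exp ((‖U‖ + 1 + 1) * ‖x‖) := by
        rw [add_one_mul (‖U‖ + 1), Real.exp_add]
        ring

theorem hasDerivAt_expPoly (w : ℂ) (k : ℕ) (U : ℂ) :
    HasDerivAt (expPoly w k) (expPoly w (k + 1) U) U := by
  obtain ⟨K, hK⟩ := exists_norm_le_mul_of_norm_apply_le (‖U‖ + 1 + 1) w
  have hbound : (fun ε => expPoly w k (U + ε) - expPoly w k U - ε • expPoly w (k + 1) U)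
      =O[𝓝 0] fun ε => ‖ε‖ ^ 2 := by
    refine .of_bound ((k + 2).factorial * K) ?_
    filter_upwards [Metric.closedBall_mem_nhds (0 : ℂ) one_pos] with ε hε
    rw [norm_pow, norm_norm]
    refine (hK _ (‖ε‖ ^ 2 * (k + 2).factorial) (by positivity) fun z =>
      norm_taylor_remainder_exp_mul_le (mem_closedBall_zero_iff.1 hε) U (z - w) k).trans_eq ?_
    ring
  exact hasDerivAt_iff_isLittleO_nhds_zero.2
    (hbound.trans_isLittleO (Asymptotics.isLittleO_norm_pow_id one_lt_two))

theorem differentiable_expPoly (w : ℂ) (k : ℕ) : Differentiable ℂ (expPoly w k) :=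
  fun U => (hasDerivAt_expPoly w k U).differentiableAt

end ExpPolynomials

section Reproducing

/-- The reproducing kernel `z ↦ e^{Uz}` at the point `conj U`. -/
def kernel (U : ℂ) : Fock := expPoly 0 0 U

theorem kernel_apply (U z : ℂ) : kernel U z = exp (U * z) := by
  simp [kernel, expPoly_apply]

theorem expPoly_zero_eq (w U : ℂ) : expPoly w 0 U = exp (-(U * w)) • kernel U := by
  ext z
  rw [Fock.smul_apply, kernel_apply, expPoly_apply, pow_zero, one_mul, ← Complex.exp_add]
  ring_nf

theorem inner_kernel (U : ℂ) (g : Fock) : inner ℂ (kernel U) g = g (conj U) := by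
  have hg := g.differentiable
  have hmean := Fock.integral_gaussian_eq (fun z => g (conj U + z) * exp (-(z * U))) (by fun_prop)
    (by simpa using (Fock.translate_memLp g (conj U)).1.integrable one_le_two)
  simp only [add_zero, zero_mul, neg_zero, Complex.exp_zero, mul_one] at hmean
  rw [← hmean, Fock.inner_def, Fock.integral_gaussian, Fock.integral_gaussian,
    ← integral_add_left_eq_self _ (conj U)]
  refine integral_congr_ae (.of_forall fun z => ?_)
  have hsq : (‖conj U + z‖ : ℂ) ^ 2 = (‖z‖ : ℂ) ^ 2 + conj U * U + conj U * conj z + z * U := by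
    rw [← mul_conj', ← mul_conj' z]
    simp only [map_add, conj_conj]
    ring
  have hexp : exp (-(‖conj U + z‖ : ℂ) ^ 2) * conj (exp (U * (conj U + z))) =
      exp (-(‖z‖ : ℂ) ^ 2) * exp (-(z * U)) := by
    rw [← exp_conj, ← Complex.exp_add, ← Complex.exp_add, hsq]
    simp only [map_add, map_mul, conj_conj]
    ring_nf
  simp only [kernel_apply, real_smul]
  push_cast
  linear_combination (Real.pi : ℂ)⁻¹ * g (conj U + z) * hexp

theorem inner_expPoly_zero_one (U : ℂ) (g : Fock) :
    inner ℂ (expPoly 0 1 U) g = deriv g (conj U) := by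
  have hinner : HasDerivAt (fun V => inner ℂ g (kernel V)) (inner ℂ g (expPoly 0 1 U)) U :=
    (innerSL ℂ g).hasFDerivAt.comp_hasDerivAt U (hasDerivAt_expPoly 0 0 U)
  have hconj : (fun V => inner ℂ g (kernel V)) = conj ∘ g ∘ conj := funext fun V => by
    rw [← inner_conj_symm, inner_kernel]
    rfl
  rw [hconj] at hinner
  have hderiv := hinner.deriv
  rw [deriv_conj_conj] at hderiv
  rw [← inner_conj_symm, ← hderiv]
  simp

theorem eq_zero_of_forall_inner_expPoly_eq_zero {w U : ℂ} {g : Fock}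
    (h : ∀ k, inner ℂ (expPoly w k U) g = 0) : g = 0 := by
  have hderiv (k : ℕ) : iteratedDeriv k (fun V => inner ℂ g (expPoly w 0 V)) =
      fun V => inner ℂ g (expPoly w k V) := by
    induction k with
    | zero => rw [iteratedDeriv_zero]
    | succ k ih =>
      rw [iteratedDeriv_succ, ih]
      exact funext fun V =>
        ((innerSL ℂ g).hasFDerivAt.comp_hasDerivAt V (hasDerivAt_expPoly w k V)).deriv
  have hzero (V : ℂ) : inner ℂ g (expPoly w 0 V) = 0 := by
    have hentire : Differentiable ℂ fun V => inner ℂ g (expPoly w 0 V) :=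
      (innerSL ℂ g).differentiable.comp (differentiable_expPoly w 0)
    rw [← taylorSeries_eq_of_entire' U V hentire]
    simp [hderiv, inner_eq_zero_symm.1 (h _)]
  ext z
  have hz := inner_eq_zero_symm.1 (hzero (conj z))
  rw [expPoly_zero_eq, inner_smul_left, inner_kernel, conj_conj] at hz
  exact (mul_eq_zero.1 hz).resolve_left ((map_ne_zero _).2 (Complex.exp_ne_zero _))

theorem dense_of_forall_expPoly_mem {w U : ℂ} {K : Submodule ℂ Fock}
    (h : ∀ k, expPoly w k U ∈ K) : Dense (K : Set Fock) := by
  rw [Submodule.dense_iff_topologicalClosure_eq_top, Submodule.topologicalClosure_eq_top_iff,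
    Submodule.eq_bot_iff]
  exact fun g hg => eq_zero_of_forall_inner_expPoly_eq_zero fun k =>
    K.mem_orthogonal g |>.1 hg _ (h k)

end Reproducing

section Domain

variable {A : Fock →ₗ.[ℂ] Fock} {ψ φ : ℂ → ℂ} {a b c : ℂ} {h : ConjParam a b c}

theorem mem_graph_of_hasDerivAt {E : Type*} [NormedAddCommGroup E] [NormedSpace ℂ E]
    {A : E →ₗ.[ℂ] E} (hA : A.IsClosed) {γ δ : ℂ → E} {γ' δ' : E} {x : ℂ} (hγ : HasDerivAt γ γ' x)
    (hδ : HasDerivAt δ δ' x) (h : ∀ y, (γ y, δ y) ∈ A.graph) : (γ', δ') ∈ A.graph :=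
  IsClosed.mem_of_tendsto hA (hγ.prodMk hδ).tendsto_slope <| .of_forall fun y =>
    A.graph.smul_mem (y - x)⁻¹ (A.graph.sub_mem (h y) (h x))

theorem kernel_mem_graph_adjoint (hd : Dense (A.domain : Set Fock)) (hA : A ≤ wcMax ψ φ) (V : ℂ) :
    (kernel V, conj (ψ (conj V)) • kernel (conj (φ (conj V)))) ∈ A.adjoint.graph := by
  rw [LinearPMap.adjoint_graph_eq_graph_adjoint hd, Submodule.mem_adjoint_iff]
  intro f g hfg
  rw [inner_smul_right, ← inner_conj_symm g, ← inner_conj_symm f, inner_kernel, inner_kernel,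
    conj_conj, apply_eq_of_mem_graph_of_le_wcMax hA hfg, map_mul, sub_self]

theorem wcConj_kernel (h : ConjParam a b c) (U : ℂ) :
    wcConj a b c h (kernel U) = (c * exp (b * conj U)) • kernel (b + a * conj U) := by
  ext z
  change c * exp (b * z) * conj (kernel U (conj (a * z + b))) = _
  rw [Fock.smul_apply, kernel_apply, kernel_apply, ← exp_conj, mul_assoc, mul_assoc,
    ← Complex.exp_add, ← Complex.exp_add, map_mul, conj_conj]
  ring_nf

theorem IsCSelfAdjoint.exists_kernel_mem_graph (hsa : IsCSelfAdjoint (wcConj a b c h) A)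
    (hA : A ≤ wcMax ψ φ) (hψ : Differentiable ℂ ψ) (hφ : Differentiable ℂ φ) :
    ∃ m n : ℂ → ℂ, Differentiable ℂ m ∧ Differentiable ℂ n ∧
      ∀ U, (kernel U, m U • kernel (n U)) ∈ A.graph := by
  refine ⟨fun U => conj c * exp (conj b * U) * ψ (conj b + conj a * U) *
      (c * exp (b * φ (conj b + conj a * U))), fun U => b + a * φ (conj b + conj a * U),
    by fun_prop, by fun_prop, fun U => ?_⟩
  have hadj := A.adjoint.graph.smul_mem (c * exp (b * conj U))
    (kernel_mem_graph_adjoint hsa.1 hA (b + a * conj U))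
  rw [Prod.smul_mk, ← wcConj_kernel h, ← (wcConj a b c h).apply_apply (_ • _ • _),
    ← Conjugation.mem_graph_conjOp, ← hsa.2] at hadj
  simp only [Conjugation.map_smul, wcConj_kernel, smul_smul, map_add, map_mul, conj_conj,
    ← exp_conj] at hadj
  exact hadj

theorem IsCSelfAdjoint.expPoly_mem_domain (hsa : IsCSelfAdjoint (wcConj a b c h) A)
    (hA : A ≤ wcMax ψ φ) (hψ : Differentiable ℂ ψ) (hφ : Differentiable ℂ φ) (w : ℂ) (k : ℕ)
    (U : ℂ) : expPoly w k U ∈ A.domain := by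
  suffices hgraph : ∃ δ : ℂ → Fock, Differentiable ℂ δ ∧ ∀ V, (expPoly w k V, δ V) ∈ A.graph by
    obtain ⟨δ, -, hδ⟩ := hgraph
    exact LinearPMap.mem_domain_of_mem_graph (hδ U)
  induction k with
  | zero =>
    obtain ⟨m, n, hm, hn, hgraph⟩ := hsa.exists_kernel_mem_graph hA hψ hφ
    refine ⟨fun V => exp (-(V * w)) • m V • kernel (n V), ?_, fun V => ?_⟩
    · have hkernel : Differentiable ℂ fun V => kernel (n V) := (differentiable_expPoly 0 0).comp hn
      fun_prop
    · rw [expPoly_zero_eq]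
      exact A.graph.smul_mem _ (hgraph V)
  | succ k ih =>
    obtain ⟨δ, hδ, hgraph⟩ := ih
    exact ⟨deriv δ, hδ.deriv, fun V => mem_graph_of_hasDerivAt hsa.isClosed
      (hasDerivAt_expPoly w k V) (hδ V).hasDerivAt hgraph⟩

end Domain

section Eigenvectors

variable {a b c ℓ G H : ℂ} {h : ConjParam a b c} {T : ℝ → Fock →ₗ.[ℂ] Fock}

theorem semicocycle_eq (t : ℝ) (z : ℂ) : semicocycle a b ℓ G H t z =
    exp ((H - ℓ * (a * G + b) * G) * t + (z - G) * (a * G + b) * (1 - exp (ℓ * t))) := by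
  rw [semicocycle, ← Complex.exp_add]
  ring_nf

theorem semicocycle_mul_expPoly_semiflow (k : ℕ) (t : ℝ) (z : ℂ) :
    semicocycle a b ℓ G H t z * expPoly G k (a * G + b) (semiflow ℓ G t z) =
      exp ((H - ℓ * (a * G + b) * G + k * ℓ) * t) * expPoly G k (a * G + b) z := by
  have hflow : semiflow ℓ G t z - G = exp (ℓ * t) * (z - G) := by
    rw [semiflow]
    ring
  rw [semicocycle_eq, expPoly_apply, expPoly_apply, hflow, mul_pow, ← Complex.exp_nat_mul]
  simp only [mul_left_comm _ ((z - G) ^ k), mul_assoc _ ((z - G) ^ k), ← Complex.exp_add]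
  ring_nf

theorem diffExpr_expPoly (p : ℂ → ℂ) (ℓ w : ℂ) (k : ℕ) (U z : ℂ) :
    diffExpr p (fun z => ℓ * (z - w)) (expPoly w k U) z =
      (p z + k * ℓ + ℓ * U * (z - w)) * expPoly w k U z := by
  have hexp : HasDerivAt (fun z => exp (U * (z - w))) (exp (U * (z - w)) * (U * 1)) z :=
    (((hasDerivAt_id z).sub_const w).const_mul U).cexp
  have hderiv := sub_mul_deriv_pow_mul w k hexp.differentiableAt
  rw [hexp.deriv] at hderiv
  change _ + ℓ * (z - w) * deriv (fun z => (z - w) ^ k * exp (U * (z - w))) z = _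
  rw [expPoly_apply]
  linear_combination ℓ * hderiv

theorem expPoly_mem_sigmaSpace
    (hT : ∀ t, 0 ≤ t → T t ≤ wcMax (semicocycle a b ℓ G H t) (semiflow ℓ G t))
    (hsa : ∀ t, 0 ≤ t → IsCSelfAdjoint (wcConj a b c h) (T t)) (k : ℕ) :
    expPoly G k (a * G + b) ∈ sigmaSpace T (H - ℓ * (a * G + b) * G + k * ℓ).re := by
  refine mem_sigmaSpace_of_forall_exp_smul_mem_graph fun t ht => ?_
  have hdom := (hsa t ht).expPoly_mem_domain (hT t ht) (differentiable_semicocycle t)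
    (differentiable_semiflow t) G k (a * G + b)
  convert (T t).mem_graph ⟨_, hdom⟩ using 2
  refine Fock.ext fun z => ?_
  rw [apply_eq_of_mem_graph_of_le_wcMax (hT t ht) ((T t).mem_graph _),
    semicocycle_mul_expPoly_semiflow, Fock.smul_apply]

theorem isUnboundedC0Semigroup_of_le_wcMax
    (hT : ∀ t, 0 ≤ t → T t ≤ wcMax (semicocycle a b ℓ G H t) (semiflow ℓ G t))
    (hsa : ∀ t, 0 ≤ t → IsCSelfAdjoint (wcConj a b c h) (T t)) : IsUnboundedC0Semigroup T := by
  refine ⟨_, (expPoly_mem_sigmaSpace hT hsa 0).1, fun hzero => ?_⟩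
  have hG := congr($hzero G)
  simp [expPoly_apply] at hG

theorem dense_domain_diffOp
    (hT : ∀ t, 0 ≤ t → T t ≤ wcMax (semicocycle a b ℓ G H t) (semiflow ℓ G t))
    (hsa : ∀ t, 0 ≤ t → IsCSelfAdjoint (wcConj a b c h) (T t)) :
    Dense ((diffOp (fun z => H - ℓ * (a * G + b) * z) (fun z => ℓ * (z - G)) T).domain :
      Set Fock) := by
  refine dense_of_forall_expPoly_mem (w := G) (U := a * G + b) fun k => ?_
  have hmem := expPoly_mem_sigmaSpace hT hsa k
  refine ⟨_, hmem, _, (sigmaSubmodule T _).smul_mem (H - ℓ * (a * G + b) * G + k * ℓ) hmem,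
    fun z => ?_⟩
  rw [diffExpr_expPoly, Fock.smul_apply]
  ring

end Eigenvectors

section NotCSelfAdjoint

variable {a b c ℓ G H : ℂ} {h : ConjParam a b c} {T : ℝ → Fock →ₗ.[ℂ] Fock} {p F : ℂ → ℂ}

theorem kernel_mem_domain_adjoint_diffOp (p F : ℂ → ℂ) (T : ℝ → Fock →ₗ.[ℂ] Fock) (U : ℂ) :
    kernel U ∈ (diffOp p F T).adjoint.domain := by
  refine LinearPMap.mem_adjoint_domain_of_exists _ ⟨conj (p (conj U)) • kernel U +
    conj (F (conj U)) • expPoly 0 1 U, fun f => ?_⟩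
  rw [inner_add_left, inner_smul_left, inner_smul_left, inner_kernel, inner_kernel,
    inner_expPoly_zero_one, conj_conj, conj_conj]
  rfl

theorem kernel_mem_domain_of_isCSelfAdjoint_diffOp
    (hsa : IsCSelfAdjoint (wcConj a b c h) (diffOp p F T)) (U : ℂ) :
    kernel U ∈ (diffOp p F T).domain := by
  have hmem : wcConj a b c h (kernel U) ∈ (diffOp p F T).adjoint.domain := by
    rw [wcConj_kernel]
    exact Submodule.smul_mem _ _ (kernel_mem_domain_adjoint_diffOp p F T _)
  rw [hsa.adjoint_eq] at hmem
  rw [← (wcConj a b c h).apply_apply (kernel U)]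
  exact hmem

theorem exp_le_norm_semicocycle (t : ℝ) :
    Real.exp ((H - ℓ * (a * G + b) * G).re * t +
        ‖a * G + b‖ ^ 2 * (Real.exp (ℓ.re * t) - 1)) ≤
      ‖semicocycle a b ℓ G H t (G - conj ((a * G + b) * exp ((ℓ.im * t : ℝ) * I)))‖ := by
  have hexp : exp (ℓ * t) = (Real.exp (ℓ.re * t) : ℝ) * exp ((ℓ.im * t : ℝ) * I) := by
    rw [ofReal_exp, ← Complex.exp_add]
    congr 1
    nth_rw 1 [← re_add_im ℓ]
    push_cast
    ring
  rw [semicocycle_eq, norm_exp, Real.exp_le_exp, add_re, re_mul_ofReal]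
  gcongr
  set u := exp ((ℓ.im * t : ℝ) * I)
  set E := a * G + b
  have hu_norm : ‖u‖ = 1 := norm_exp_ofReal_mul_I _
  have hexponent : (G - conj (E * u) - G) * E * (1 - exp (ℓ * t)) =
      (‖E‖ ^ 2 * Real.exp (ℓ.re * t) : ℝ) - (‖E‖ ^ 2 : ℝ) * conj u := by
    have hu_mul : u * conj u = 1 := by rw [mul_conj', hu_norm]; norm_num
    have hE_mul : E * conj E = (‖E‖ : ℂ) ^ 2 := mul_conj' E
    rw [hexp, map_mul]
    push_cast
    linear_combination (exp (ℓ.re * t) * E * conj E) * hu_mul +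
      (exp (ℓ.re * t) - conj u) * hE_mul
  have hu_re : u.re ≤ 1 := hu_norm ▸ re_le_norm u
  rw [hexponent, sub_re, ofReal_re, re_ofReal_mul, conj_re]
  nlinarith [sq_nonneg ‖E‖]

theorem tendsto_mul_exp_mul_sub_mul_atTop {q r : ℝ} (hq : 0 < q) (hr : 0 < r) (s : ℝ) :
    Filter.Tendsto (fun t => q * Real.exp (r * t) - s * t) .atTop .atTop := by
  have hratio := (tendsto_exp_mul_div_rpow_atTop 1 r hr).const_mul_atTop hq
  refine (Filter.tendsto_id.atTop_mul_atTop₀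
    (Filter.tendsto_atTop_add_const_right _ (-s) hratio)).congr' ?_
  filter_upwards [Filter.eventually_gt_atTop 0] with t ht
  rw [Real.rpow_one, id]
  field_simp
  ring

theorem kernel_zero_notMem_sigmaSpace
    (hT : ∀ t, 0 ≤ t → T t ≤ wcMax (semicocycle a b ℓ G H t) (semiflow ℓ G t)) (hℓ : 0 < ℓ.re)
    (hE : a * G + b ≠ 0) (ω : ℝ) : kernel 0 ∉ sigmaSpace T ω := fun hmem => by
  obtain ⟨u, M, hu, hM⟩ := mem_sigmaSpace_iff.1 hmem
  set E := a * G + b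
  set ρ := (H - ℓ * E * G).re
  set r := ‖G‖ + ‖E‖
  have hbound : ∀ t, 0 ≤ t → Real.exp (ρ * t + ‖E‖ ^ 2 * (Real.exp (ℓ.re * t) - 1)) ≤
      Real.exp (r ^ 2 / 2) * (M * Real.exp (ω * t)) := fun t ht => by
    set z := G - conj (E * exp ((ℓ.im * t : ℝ) * I))
    have hz_norm : ‖z‖ ≤ r := by
      refine (norm_sub_le _ _).trans_eq ?_
      rw [norm_conj, norm_mul, norm_exp_ofReal_mul_I, mul_one]
    have huz : u t z = semicocycle a b ℓ G H t z := by
      rw [apply_eq_of_mem_graph_of_le_wcMax (hT t ht) (hu.mem_graph t ht), kernel_apply, zero_mul,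
        Complex.exp_zero, mul_one]
    calc _ ≤ ‖u t z‖ := huz ▸ exp_le_norm_semicocycle t
      _ ≤ Real.exp (‖z‖ ^ 2 / 2) * ‖u t‖ := (u t).norm_apply_le z
      _ ≤ _ := by gcongr; exact hM t ht
  have hgrowth := Real.tendsto_exp_atTop.comp <| Filter.tendsto_atTop_add_const_right .atTop
    (-‖E‖ ^ 2) (tendsto_mul_exp_mul_sub_mul_atTop (pow_pos (norm_pos_iff.2 hE) 2) hℓ (ω - ρ))
  obtain ⟨t, hlarge, ht⟩ := ((hgrowth.eventually_gt_atTop (Real.exp (r ^ 2 / 2) * M)).and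
    (Filter.eventually_ge_atTop 0)).exists
  refine (hbound t ht).not_gt ?_
  rw [← mul_assoc, ← lt_div_iff₀ (Real.exp_pos _), ← Real.exp_sub]
  convert hlarge using 1
  simp only [Function.comp_apply]
  ring_nf

theorem not_isCSelfAdjoint_diffOp (h : ConjParam a b c)
    (hT : ∀ t, 0 ≤ t → T t ≤ wcMax (semicocycle a b ℓ G H t) (semiflow ℓ G t)) (hℓ : 0 < ℓ.re)
    (hE : a * G + b ≠ 0) (p F : ℂ → ℂ) : ¬ IsCSelfAdjoint (wcConj a b c h) (diffOp p F T) :=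
  fun hsa => by
    obtain ⟨ω, hmem, -⟩ := kernel_mem_domain_of_isCSelfAdjoint_diffOp hsa 0
    exact kernel_zero_notMem_sigmaSpace hT hℓ hE ω hmem

end NotCSelfAdjoint

end CSym

end

theorem mainTheorem3_general (a b c : ℂ) (habc : CSym.ConjParam a b c) (ℓ G H : ℂ)
    (T : ℝ → CSym.Fock →ₗ.[ℂ] CSym.Fock)
    (hW : ∀ t : ℝ, 0 ≤ t →
      T t ≤ CSym.wcMax (CSym.semicocycle a b ℓ G H t) (CSym.semiflow ℓ G t))
    (hsa : ∀ t : ℝ, 0 ≤ t → CSym.IsCSelfAdjoint (CSym.wcConj a b c habc) (T t)) :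
    ∃ R : CSym.Fock →ₗ.[ℂ] CSym.Fock, CSym.IsGenerator T R ∧
      ((R.domain : Set CSym.Fock) =
          ⋃ ω : ℝ, {f | f ∈ CSym.sigmaSpace T ω ∧ ∃ g ∈ CSym.sigmaSpace T ω, ∀ z : ℂ,
            g z = (H - ℓ * (a * G + b) * z) * f z + ℓ * (z - G) * deriv f z} ∧
        ∀ (f : R.domain) (z : ℂ), R f z =
          (H - ℓ * (a * G + b) * z) * (f : CSym.Fock) z +
            ℓ * (z - G) * deriv (f : CSym.Fock) z) ∧
      CSym.IsCSymmetric (CSym.wcConj a b c habc) R ∧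
      Dense (R.domain : Set CSym.Fock) ∧
      CSym.IsUnboundedC0Semigroup (fun t => (T t).adjoint) ∧
      (∃ B, CSym.IsGenerator (fun t => (T t).adjoint) B) ∧
      (0 < ℓ.re → a * G + b ≠ 0 →
        ¬ CSym.IsCSelfAdjoint (CSym.wcConj a b c habc) R ∧
        ¬ CSym.IsGenerator (fun t => (T t).adjoint) R.adjoint) ∧
      CSym.pointSpectrum R ⊆ {η | ∃ k : ℕ, η = H - ℓ * (a * G + b) * G + k * ℓ} := by
  have hflow := CSym.isWeightedFlow_semiflow (a := a) (b := b) (ℓ := ℓ) (G := G) (H := H)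
  have hadj := fun t ht => (hsa t ht).adjoint_eq
  have hR := hflow.isGenerator_diffOp hW fun t ht => (hsa t ht).isClosed
  have hdense := CSym.dense_domain_diffOp hW hsa
  refine ⟨_, hR, ⟨CSym.coe_domain_diffOp _ _ T, fun _ _ => rfl⟩,
    hflow.isCSymmetric_diffOp hW fun t ht => (hsa t ht).isCSymmetric, hdense,
    (CSym.isUnboundedC0Semigroup_of_le_wcMax hW hsa).map_conj hadj, ⟨_, hR.map_conj hadj⟩,
    fun hℓ hE => ?_, CSym.pointSpectrum_diffOp_subset (by fun_prop) T⟩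
  have hn := CSym.not_isCSelfAdjoint_diffOp habc hW hℓ hE
    (fun z => H - ℓ * (a * G + b) * z) fun z => ℓ * (z - G)
  exact ⟨hn, CSym.not_isGenerator_adjoint hadj hR hdense hn⟩

theorem mainTheorem3 (a b c : ℂ) (habc : CSym.ConjParam a b c) (ℓ G H : ℂ) (hℓ : ℓ ≠ 0)
    (T : ℝ → CSym.Fock →ₗ.[ℂ] CSym.Fock)
    (hW : ∀ t : ℝ, 0 ≤ t →
      T t ≤ CSym.wcMax (CSym.semicocycle a b ℓ G H t) (CSym.semiflow ℓ G t))
    (hT : CSym.IsUnboundedC0Semigroup T)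
    (hsa : ∀ t : ℝ, 0 ≤ t → CSym.IsCSelfAdjoint (CSym.wcConj a b c habc) (T t)) :
    ∃ R : CSym.Fock →ₗ.[ℂ] CSym.Fock, CSym.IsGenerator T R ∧
      -- the domain and the action of the generator
      ((R.domain : Set CSym.Fock) =
          ⋃ ω : ℝ, {f | f ∈ CSym.sigmaSpace T ω ∧ ∃ g ∈ CSym.sigmaSpace T ω, ∀ z : ℂ,
            g z = (H - ℓ * (a * G + b) * z) * f z + ℓ * (z - G) * deriv f z} ∧
        ∀ (f : R.domain) (z : ℂ), R f z =
          (H - ℓ * (a * G + b) * z) * (f : CSym.Fock) z +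
            ℓ * (z - G) * deriv (f : CSym.Fock) z) ∧
      -- symmetry of the generator
      CSym.IsCSymmetric (CSym.wcConj a b c habc) R ∧
      -- the case of a real and positive `ℓ`; the adjoints of `R` and of all `T t` exist
      (0 < ℓ.re ∧ ℓ.im = 0 ∧ a * G + b ≠ 0 →
        Dense (R.domain : Set CSym.Fock) ∧
        ¬ CSym.IsCSelfAdjoint (CSym.wcConj a b c habc) R ∧
        CSym.IsUnboundedC0Semigroup (fun t => (T t).adjoint) ∧
        (∃ B, CSym.IsGenerator (fun t => (T t).adjoint) B) ∧
        ¬ CSym.IsGenerator (fun t => (T t).adjoint) R.adjoint) ∧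
      -- the point spectrum
      CSym.pointSpectrum R ⊆ {η | ∃ k : ℕ, η = H - ℓ * (a * G + b) * G + k * ℓ} := by
  obtain ⟨R, hR, hact, hsymm, hdense, hadj, hadj_gen, hnot, hspec⟩ :=
    mainTheorem3_general a b c habc ℓ G H T hW hsa
  exact ⟨R, hR, hact, hsymm, fun ⟨hpos, _, hE⟩ =>
    ⟨hdense, (hnot hpos hE).1, hadj, hadj_gen, (hnot hpos hE).2⟩, hspec⟩
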